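/- **Setting.** Sequential Core Erlang. *Values* are integers, atoms, variables, function identifiers $f/k$, closures $\mathit{clos}(\mathit{ext},[x_1,\dots,x_n],e)$ (where $\mathit{ext}$ is a list of mutually recursive function definitions $f/k=\mathtt{fun}(x_1,\dots,x_k)\to e'$), lists $[v_1|v_2]$ and $[\,]$, tuples, and maps. *Expressions* are values, $\mathtt{fun}$-abstractions, value lists $\langle e_1,\dots,e_n\rangle$, list, tuple and map expressions, calls of built-in functions, primitive operations, applications, and $\mathtt{case}$ (clauses with lists of patterns and guards), $\mathtt{let}$, $\mathtt{do}$, $\mathtt{letrec}$ and $\mathtt{try}$ expressions. A *redex* is a value sequence $\langle v_1,\dots,v_k\rangle$, an exception $\{c,v_r,v_d\}^X$ (class $c$, reason $v_r$, details $v_d$), an expression, or the hole $\Box$; a *result* is a value sequence or an exception. A *frame* is a non-value expression with one subexpression, the next one to be evaluated, replaced by $\Box$; a *frame stack* $K$ is a list of frames, $\varepsilon$ is the empty one. $\langle K,r\rangle\longrightarrow\langle K',r'\rangle$ is the small-step frame-stack semantics of Core Erlang (with built-in functions of the module $\mathtt{erlang}$, among them the arithmetic, comparison, list and tuple functions, the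 type tests including $\mathtt{is\_function}/2$, and $\mathtt{fun\_info}/2$ for the arity of a function). Write $\langle K,r\rangle\Downarrow^n$ if $\langle K,r\rangle\longrightarrow^n\langle\varepsilon,\mathit{res}\rangle$ for some result $\mathit{res}$, and $\langle K,r\rangle\Downarrow$ if this holds for some $n$. A value, expression or redex is closed if it has no free variables and no free function identifiers; a frame is closed if filling its hole with a closed expression gives a closed expression, and a frame stack is closed if all its frames are. **CIU preorder.** For redexes, $r_1\leq_{\mathit{ciu}}r_2$ iff $r_1$ and $r_2$ are closed and, for every closed frame stack $K$, $\langle K,r_1\rangle\Downarrow$ implies $\langle K,r_2\rangle\Downarrow$. **Logical relations.** The following relations between closed objects are defined by mutual recursion on the step index $n\in\mathbb N$. - $(v_1,v_2)\in\mathbb V_n$: equal integers are related; equal atoms are related; $[\,]$ is related to $[\,]$; $[v_1|v_2]$ and $[v_1'|v_2']$ are related iff $(v_1,v_1'),(v_2,v_2')\in\mathbb V_n$; tuples are related iff they have the same size and are related element-wise in $\mathbb V_n$, and so are maps (keys and values, entry by entry); $\mathit{clos}(\mathit{ext},[x_1,\dots,x_k],e)$ and $\mathit{clos}(\mathit{ext}',[y_1,\dots,y_{k'}],e')$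 are related iff $k=k'$ and for all $m<n$ and all $(u_1,u_1'),\dots,(u_k,u_k')\in\mathbb V_m$, the expressions $e[\mathit{cl}(\mathit{ext}),x_1\mapsto u_1,\dots,x_k\mapsto u_k]$ and $e'[\mathit{cl}(\mathit{ext}'),y_1\mapsto u_1',\dots,y_k\mapsto u_k']$ are related in $\mathbb E_m$, where $\mathit{cl}(\mathit{ext})$ replaces every function identifier defined in $\mathit{ext}$ by its closure over $\mathit{ext}$. No other values are related. - $(e_1,e_2)\in\mathbb E_n$ iff for all $m\le n$ and all $(K_1,K_2)\in\mathbb K_m$, $\langle K_1,e_1\rangle\Downarrow^m$ implies $\langle K_2,e_2\rangle\Downarrow$. - $(\{c,v_r,v_d\}^X,\{c',v_r',v_d'\}^X)\in\mathbb X_n$ iff $c=c'$ and $(v_r,v_r'),(v_d,v_d')\in\mathbb V_n$. - $(K_1,K_2)\in\mathbb K_n$ iff for all $m\le n$: $\langle K_1,\langle u_1,\dots,u_k\rangle\rangle\Downarrow^m$ implies $\langle K_2,\langle u_1',\dots,u_k'\rangle\rangle\Downarrow$ whenever $(u_1,u_1'),\dots,(u_k,u_k')\in\mathbb V_m$; $\langle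 K_1,\mathit{exc}_1\rangle\Downarrow^m$ implies $\langle K_2,\mathit{exc}_2\rangle\Downarrow$ whenever $(\mathit{exc}_1,\mathit{exc}_2)\in\mathbb X_m$; and $\langle K_1,\Box\rangle\Downarrow^m$ implies $\langle K_2,\Box\rangle\Downarrow$. **Theorem (Termination is sufficient).** For all closed values $v_1,v_2$, if $v_1\leq_{\mathit{ciu}}v_2$, then $(v_1,v_2)\in\mathbb V_n$ for every step index $n\in\mathbb N$. -/

import Mathlib

namespace CoreErlang

/-! ## Syntax -/

/-- Atoms, given by their spelling (a list of character codes). -/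
abbrev Atom := List ℕ

/-- Variables: a countably infinite set of names. -/
abbrev Var := ℕ

/-- The atom `true`. -/
def atTrue : Atom := [116, 114, 117, 101]
/-- The atom `false`. -/
def atFalse : Atom := [102, 97, 108, 115, 101]
/-- The atom `throw`. -/
def atThrow : Atom := [116, 104, 114, 111, 119]
/-- The atom `exit`. -/
def atExit : Atom := [101, 120, 105, 116]
/-- The atom `error`. -/
def atError : Atom := [101, 114, 114, 111, 114]
/-- The atom `erlang`. -/
def atErlang : Atom := [101, 114, 108, 97, 110, 103]
/-- The atom `if_clause`. -/
def atIfClause : Atom := [105, 102, 95, 99, 108, 97, 117, 115, 101]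
/-- The atom `badarg`. -/
def atBadarg : Atom := [98, 97, 100, 97, 114, 103]
/-- The atom `badarith`. -/
def atBadarith : Atom := [98, 97, 100, 97, 114, 105, 116, 104]
/-- The atom `badfun`. -/
def atBadfun : Atom := [98, 97, 100, 102, 117, 110]
/-- The atom `badarity`. -/
def atBadarity : Atom := [98, 97, 100, 97, 114, 105, 116, 121]
/-- The atom `undef`. -/
def atUndef : Atom := [117, 110, 100, 101, 102]
/-- The atom `arity`. -/
def atArity : Atom := [97, 114, 105, 116, 121]
/-- The atom `match_fail`. -/
def atMatchFail : Atom := [109, 97, 116, 99, 104, 95, 102, 97, 105, 108]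

/-- Names: variables `x` and function identifiers `f/k`. -/
inductive Name where
  | var (x : Var)
  | fid (f : Atom) (k : ℕ)
deriving DecidableEq

/-- Patterns. -/
inductive Pat where
  | int (i : ℤ)
  | atom (a : Atom)
  | var (x : Var)
  | cons (p₁ p₂ : Pat)
  | nil
  | tuple (ps : List Pat)
  | map (ps : List (Pat × Pat))

mutual

/-- Values. -/
inductive Val where
  | int (i : ℤ)
  | atom (a : Atom)
  | var (x : Var)
  | fid (f : Atom) (k : ℕ)
  | clos (ext : List ClosItem) (xs : List Var) (e : Exp)
  | cons (v₁ v₂ : Val)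
  | nil
  | tuple (vs : List Val)
  | map (kvs : List (Val × Val))

/-- Function definitions `f/k = fun(x₁, …, x_k) → e`; the arity `k` is the number of parameters. -/
inductive ClosItem where
  | mk (f : Atom) (xs : List Var) (e : Exp)

/-- Clauses `ps when g → b`. -/
inductive Clause where
  | mk (ps : List Pat) (g b : Exp)

/-- Expressions that are not values. -/
inductive NonVal where
  | lam (xs : List Var) (e : Exp)
  | values (es : List Exp)
  | cons (e₁ e₂ : Exp)
  | tuple (es : List Exp)
  | map (kvs : List (Exp × Exp))
  | call (em ef : Exp) (es : List Exp)
  | primop (a : Atom) (es : List Exp)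
  | apply (e : Exp) (es : List Exp)
  | case (e : Exp) (cls : List Clause)
  | letIn (xs : List Var) (e₁ e₂ : Exp)
  | seq (e₁ e₂ : Exp)
  | letrec (ext : List ClosItem) (e : Exp)
  | tryOf (e₁ : Exp) (xs : List Var) (e₂ : Exp) (ys : List Var) (e₃ : Exp)

/-- Expressions. -/
inductive Exp where
  | nonval (n : NonVal)
  | val (v : Val)

end

/-- Exception classes. -/
inductive ExcClass where
  | throw
  | exit
  | error

/-- Exception classes are atoms. -/
def ExcClass.toAtom : ExcClass → Atom
  | .throw => atThrow
  | .exit => atExit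
  | .error => atError

/-- Exceptions: class, reason and details. -/
structure Exc where
  cls : ExcClass
  reason : Val
  details : Val

/-- Redexes: value sequences, exceptions, expressions, and the hole. -/
inductive Redex where
  | vals (vs : List Val)
  | exc (x : Exc)
  | exp (e : Exp)
  | box

/-- Results: exceptions and value sequences. -/
def Redex.IsResult : Redex → Prop
  | .vals _ => True
  | .exc _ => True
  | .exp _ => False
  | .box => False

/-- Frame identifiers. -/
inductive FrameId where
  | tuple
  | values
  | call (vm vf : Val)
  | primop (a : Atom)
  | map
  | app (vf : Val)

/-- Frames. -/
inductive Frame where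
  /-- `id(v₁, …, □, e₁, …)` -/
  | params (id : FrameId) (vs : List Val) (es : List Exp)
  /-- `[e₁ | □]` -/
  | consTail (e₁ : Exp)
  /-- `[□ | v₂]` -/
  | consHead (v₂ : Val)
  /-- `call □:ef(es)` -/
  | callMod (ef : Exp) (es : List Exp)
  /-- `call vm:□(es)` -/
  | callFun (vm : Val) (es : List Exp)
  /-- `apply □(es)` -/
  | apply (es : List Exp)
  /-- `case □ of cls end` -/
  | caseOf (cls : List Clause)
  /-- `case vs of ps when □ → b; cls end` -/
  | caseGuard (vs : List Val) (ps : List Pat) (b : Exp) (cls : List Clause)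
  /-- `let xs = □ in e₂` -/
  | letIn (xs : List Var) (e₂ : Exp)
  /-- `do □ e₂` -/
  | seq (e₂ : Exp)
  /-- `try □ of xs → e₂ catch ys → e₃` -/
  | tryOf (xs : List Var) (e₂ : Exp) (ys : List Var) (e₃ : Exp)

/-- Frame stacks; the head of the list is the top of the stack. -/
abbrev FrameStack := List Frame

/-! ## Names and scoping -/

/-- The set of variables in a list, as names. -/
def varNames (xs : List Var) : Set Name := {y | ∃ x ∈ xs, y = Name.var x}

/-- The name `f/k` bound by a function definition. -/
def ClosItem.name : ClosItem → Name
  | .mk f xs _ => .fid f xs.length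

/-- The function identifiers bound by a list of function definitions. -/
def namesOf (ext : List ClosItem) : Set Name := {y | ∃ c ∈ ext, y = c.name}

mutual

/-- The variables of a pattern. -/
def Pat.vars : Pat → List Var
  | .int _ => []
  | .atom _ => []
  | .var x => [x]
  | .cons p q => p.vars ++ q.vars
  | .nil => []
  | .tuple ps => Pat.varsList ps
  | .map ps => Pat.varsPairs ps

/-- The variables of a list of patterns. -/
def Pat.varsList : List Pat → List Var
  | [] => []
  | p :: ps => p.vars ++ Pat.varsList ps

/-- The variables of a list of pairs of patterns. -/
def Pat.varsPairs : List (Pat × Pat) → List Var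
  | [] => []
  | (p, q) :: ps => p.vars ++ q.vars ++ Pat.varsPairs ps

end

mutual

/-- `Γ ⊢ v`: all free names of `v` are in `Γ`. -/
def Val.Scoped : Val → Set Name → Prop
  | .int _, _ => True
  | .atom _, _ => True
  | .var x, Γ => Name.var x ∈ Γ
  | .fid f k, Γ => Name.fid f k ∈ Γ
  | .clos ext xs e, Γ =>
      ClosItem.ScopedAll ext (Γ ∪ namesOf ext) ∧ e.Scoped (Γ ∪ namesOf ext ∪ varNames xs)
  | .cons v w, Γ => v.Scoped Γ ∧ w.Scoped Γ
  | .nil, _ => True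
  | .tuple vs, Γ => Val.ScopedAll vs Γ
  | .map kvs, Γ => Val.ScopedPairs kvs Γ

/-- All values of a list are scoped. -/
def Val.ScopedAll : List Val → Set Name → Prop
  | [], _ => True
  | v :: vs, Γ => v.Scoped Γ ∧ Val.ScopedAll vs Γ

/-- All values of a list of pairs are scoped. -/
def Val.ScopedPairs : List (Val × Val) → Set Name → Prop
  | [], _ => True
  | (k, v) :: kvs, Γ => k.Scoped Γ ∧ v.Scoped Γ ∧ Val.ScopedPairs kvs Γ

/-- All bodies in a list of function definitions are scoped, where `Γ` already contains the
names that the list binds. -/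
def ClosItem.ScopedAll : List ClosItem → Set Name → Prop
  | [], _ => True
  | .mk _ xs e :: ext, Γ => e.Scoped (Γ ∪ varNames xs) ∧ ClosItem.ScopedAll ext Γ

/-- All clauses of a list are scoped. -/
def Clause.ScopedAll : List Clause → Set Name → Prop
  | [], _ => True
  | .mk ps g b :: cls, Γ =>
      g.Scoped (Γ ∪ varNames (Pat.varsList ps)) ∧ b.Scoped (Γ ∪ varNames (Pat.varsList ps)) ∧
        Clause.ScopedAll cls Γ

/-- `Γ ⊢ n` for non-values. -/
def NonVal.Scoped : NonVal → Set Name → Prop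
  | .lam xs e, Γ => e.Scoped (Γ ∪ varNames xs)
  | .values es, Γ => Exp.ScopedAll es Γ
  | .cons e₁ e₂, Γ => e₁.Scoped Γ ∧ e₂.Scoped Γ
  | .tuple es, Γ => Exp.ScopedAll es Γ
  | .map kvs, Γ => Exp.ScopedPairs kvs Γ
  | .call em ef es, Γ => em.Scoped Γ ∧ ef.Scoped Γ ∧ Exp.ScopedAll es Γ
  | .primop _ es, Γ => Exp.ScopedAll es Γ
  | .apply e es, Γ => e.Scoped Γ ∧ Exp.ScopedAll es Γ
  | .case e cls, Γ => e.Scoped Γ ∧ Clause.ScopedAll cls Γ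
  | .letIn xs e₁ e₂, Γ => e₁.Scoped Γ ∧ e₂.Scoped (Γ ∪ varNames xs)
  | .seq e₁ e₂, Γ => e₁.Scoped Γ ∧ e₂.Scoped Γ
  | .letrec ext e, Γ =>
      ClosItem.ScopedAll ext (Γ ∪ namesOf ext) ∧ e.Scoped (Γ ∪ namesOf ext)
  | .tryOf e₁ xs e₂ ys e₃, Γ =>
      e₁.Scoped Γ ∧ e₂.Scoped (Γ ∪ varNames xs) ∧ e₃.Scoped (Γ ∪ varNames ys)

/-- `Γ ⊢ e` for expressions. -/
def Exp.Scoped : Exp → Set Name → Prop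
  | .nonval n, Γ => n.Scoped Γ
  | .val v, Γ => v.Scoped Γ

/-- All expressions of a list are scoped. -/
def Exp.ScopedAll : List Exp → Set Name → Prop
  | [], _ => True
  | e :: es, Γ => e.Scoped Γ ∧ Exp.ScopedAll es Γ

/-- All expressions of a list of pairs are scoped. -/
def Exp.ScopedPairs : List (Exp × Exp) → Set Name → Prop
  | [], _ => True
  | (k, v) :: kvs, Γ => k.Scoped Γ ∧ v.Scoped Γ ∧ Exp.ScopedPairs kvs Γ

end

/-- `Γ ⊢ r` for redexes. -/
def Redex.Scoped : Redex → Set Name → Prop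
  | .vals vs, Γ => Val.ScopedAll vs Γ
  | .exc x, Γ => x.reason.Scoped Γ ∧ x.details.Scoped Γ
  | .exp e, Γ => e.Scoped Γ
  | .box, _ => True

/-- Closed values. -/
def Val.Closed (v : Val) : Prop := v.Scoped ∅

/-- Closed expressions. -/
def Exp.Closed (e : Exp) : Prop := e.Scoped ∅

/-- Closed redexes. -/
def Redex.Closed (r : Redex) : Prop := r.Scoped ∅

/-- Closed frame identifiers. -/
def FrameId.Closed : FrameId → Prop
  | .tuple => True
  | .values => True
  | .call vm vf => vm.Closed ∧ vf.Closed
  | .primop _ => True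
  | .map => True
  | .app vf => vf.Closed

/-- Closed frames: filling the hole with a closed expression gives a (well-formed) closed
expression. For a map frame this includes that keys and values pair up. In a `caseGuard` frame
the pattern variables have already been substituted in the body. -/
def Frame.Closed : Frame → Prop
  | .params id vs es =>
      id.Closed ∧ Val.ScopedAll vs ∅ ∧ Exp.ScopedAll es ∅ ∧
        (id = .map → Even (vs.length + 1 + es.length))
  | .consTail e₁ => e₁.Closed
  | .consHead v₂ => v₂.Closed
  | .callMod ef es => ef.Closed ∧ Exp.ScopedAll es ∅
  | .callFun vm es => vm.Closed ∧ Exp.ScopedAll es ∅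
  | .apply es => Exp.ScopedAll es ∅
  | .caseOf cls => Clause.ScopedAll cls ∅
  | .caseGuard vs _ b cls => Val.ScopedAll vs ∅ ∧ b.Closed ∧ Clause.ScopedAll cls ∅
  | .letIn xs e₂ => e₂.Scoped (varNames xs)
  | .seq e₂ => e₂.Closed
  | .tryOf xs e₂ ys e₃ => e₂.Scoped (varNames xs) ∧ e₃.Scoped (varNames ys)

/-- A frame stack is closed if all its frames are. -/
def FrameStack.Closed (K : FrameStack) : Prop := ∀ F ∈ K, F.Closed

/-! ## Substitution -/

/-- Parallel substitutions of values for names; `none` leaves the name unchanged. -/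
def Subst := Name → Option Val

open Classical in
/-- Removing the names in `s` from the domain of a substitution. -/
noncomputable def Subst.erase (σ : Subst) (s : Set Name) : Subst :=
  fun y => if y ∈ s then none else σ y

/-- The substitution that uses `σ` first, and `τ` on names outside the domain of `σ`. -/
def Subst.union (σ τ : Subst) : Subst := fun y => (σ y).or (τ y)

/-- The substitution given by a list of variable bindings. For a repeated variable the first
binding counts. -/
def Subst.ofBindings (l : List (Var × Val)) : Subst
  | .var x => l.lookup x
  | .fid _ _ => none

/-- The substitution `x₁ ↦ v₁, …, xₙ ↦ vₙ`. -/
def Subst.ofVars (xs : List Var) (vs : List Val) : Subst := Subst.ofBindings (xs.zip vs)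

/-- `findClos all ext y`: the closure (with recursive definitions `all`) made from the first
definition of `y` in `ext`. -/
def findClos (all : List ClosItem) : List ClosItem → Name → Option Val
  | [], _ => none
  | .mk f xs e :: ext, y =>
      if y = .fid f xs.length then some (.clos all xs e) else findClos all ext y

/-- The substitution that maps every `f/k` defined in `ext` to its closure over `ext`. -/
def mkClosList (ext : List ClosItem) : Subst := findClos ext ext

mutual

/-- Parallel substitution in values. Bound names are removed from the substitution under their
binders. Closed configurations only ever substitute closed values, which contain no name that
could be captured, so that no renaming of bound names is needed. -/
noncomputable def Val.subst : Val → Subst → Val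
  | .int i, _ => .int i
  | .atom a, _ => .atom a
  | .var x, σ => (σ (.var x)).getD (.var x)
  | .fid f k, σ => (σ (.fid f k)).getD (.fid f k)
  | .clos ext xs e, σ =>
      .clos (ClosItem.substAll ext (σ.erase (namesOf ext))) xs
        (e.subst (σ.erase (namesOf ext ∪ varNames xs)))
  | .cons v w, σ => .cons (v.subst σ) (w.subst σ)
  | .nil, _ => .nil
  | .tuple vs, σ => .tuple (Val.substAll vs σ)
  | .map kvs, σ => .map (Val.substPairs kvs σ)

/-- Substitution in lists of values. -/
noncomputable def Val.substAll : List Val → Subst → List Val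
  | [], _ => []
  | v :: vs, σ => v.subst σ :: Val.substAll vs σ

/-- Substitution in lists of pairs of values. -/
noncomputable def Val.substPairs : List (Val × Val) → Subst → List (Val × Val)
  | [], _ => []
  | (k, v) :: kvs, σ => (k.subst σ, v.subst σ) :: Val.substPairs kvs σ

/-- Substitution in lists of function definitions. -/
noncomputable def ClosItem.substAll : List ClosItem → Subst → List ClosItem
  | [], _ => []
  | .mk f xs e :: ext, σ => .mk f xs (e.subst (σ.erase (varNames xs))) :: ClosItem.substAll ext σ

/-- Substitution in lists of clauses. -/
noncomputable def Clause.substAll : List Clause → Subst → List Clause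
  | [], _ => []
  | .mk ps g b :: cls, σ =>
      .mk ps (g.subst (σ.erase (varNames (Pat.varsList ps))))
        (b.subst (σ.erase (varNames (Pat.varsList ps)))) :: Clause.substAll cls σ

/-- Substitution in non-values. -/
noncomputable def NonVal.subst : NonVal → Subst → NonVal
  | .lam xs e, σ => .lam xs (e.subst (σ.erase (varNames xs)))
  | .values es, σ => .values (Exp.substAll es σ)
  | .cons e₁ e₂, σ => .cons (e₁.subst σ) (e₂.subst σ)
  | .tuple es, σ => .tuple (Exp.substAll es σ)
  | .map kvs, σ => .map (Exp.substPairs kvs σ)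
  | .call em ef es, σ => .call (em.subst σ) (ef.subst σ) (Exp.substAll es σ)
  | .primop a es, σ => .primop a (Exp.substAll es σ)
  | .apply e es, σ => .apply (e.subst σ) (Exp.substAll es σ)
  | .case e cls, σ => .case (e.subst σ) (Clause.substAll cls σ)
  | .letIn xs e₁ e₂, σ => .letIn xs (e₁.subst σ) (e₂.subst (σ.erase (varNames xs)))
  | .seq e₁ e₂, σ => .seq (e₁.subst σ) (e₂.subst σ)
  | .letrec ext e, σ =>
      .letrec (ClosItem.substAll ext (σ.erase (namesOf ext))) (e.subst (σ.erase (namesOf ext)))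
  | .tryOf e₁ xs e₂ ys e₃, σ =>
      .tryOf (e₁.subst σ) xs (e₂.subst (σ.erase (varNames xs)))
        ys (e₃.subst (σ.erase (varNames ys)))

/-- Substitution in expressions. -/
noncomputable def Exp.subst : Exp → Subst → Exp
  | .nonval n, σ => .nonval (n.subst σ)
  | .val v, σ => .val (v.subst σ)

/-- Substitution in lists of expressions. -/
noncomputable def Exp.substAll : List Exp → Subst → List Exp
  | [], _ => []
  | e :: es, σ => e.subst σ :: Exp.substAll es σ

/-- Substitution in lists of pairs of expressions. -/
noncomputable def Exp.substPairs : List (Exp × Exp) → Subst → List (Exp × Exp)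
  | [], _ => []
  | (k, v) :: kvs, σ => (k.subst σ, v.subst σ) :: Exp.substPairs kvs σ

end

/-! ## Pattern matching -/

mutual

/-- Matching a value against a pattern: the variable bindings if it succeeds, and `none` if it
does not. -/
def Pat.matchVal : Pat → Val → Option (List (Var × Val))
  | .var x, v => some [(x, v)]
  | .int i, .int j => if i = j then some [] else none
  | .atom a, .atom b => if a = b then some [] else none
  | .nil, .nil => some []
  | .cons p q, .cons v w => (p.matchVal v).bind fun l => (q.matchVal w).map fun l' => l ++ l'
  | .tuple ps, .tuple vs => Pat.matchList ps vs
  | .map ps, .map kvs => Pat.matchPairs ps kvs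
  | _, _ => none

/-- Pairwise matching of a list of patterns and a value sequence. -/
def Pat.matchList : List Pat → List Val → Option (List (Var × Val))
  | [], [] => some []
  | p :: ps, v :: vs =>
      (p.matchVal v).bind fun l => (Pat.matchList ps vs).map fun l' => l ++ l'
  | _, _ => none

/-- Pairwise matching of the entries of a map pattern and a map. -/
def Pat.matchPairs : List (Pat × Pat) → List (Val × Val) → Option (List (Var × Val))
  | [], [] => some []
  | (p, q) :: ps, (k, v) :: kvs =>
      (p.matchVal k).bind fun l₁ => (q.matchVal v).bind fun l₂ =>
        (Pat.matchPairs ps kvs).map fun l₃ => l₁ ++ l₂ ++ l₃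
  | _, _ => none

end

/-! ## The order of terms, and maps -/

/-- The rank of a kind of value in the Erlang term order
`number < atom < fun < tuple < map < nil < list` (free names are not terms; they come last). -/
def Val.rank : Val → ℕ
  | .int _ => 0
  | .atom _ => 1
  | .clos _ _ _ => 2
  | .tuple _ => 3
  | .map _ => 4
  | .nil => 5
  | .cons _ _ => 6
  | .var _ => 7
  | .fid _ _ => 8

mutual

/-- The Erlang term order. Tuples and maps are compared by size first, and maps then by keys
before values. Closures carry no identity, and are compared by their arity only. -/
def Val.cmp : Val → Val → Ordering
  | .int i, .int j => compare i j
  | .atom a, .atom b => compareOfLessAndEq a b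
  | .clos _ xs _, .clos _ ys _ => compare xs.length ys.length
  | .tuple vs, .tuple ws => (compare vs.length ws.length).then (Val.cmpList vs ws)
  | .map kvs, .map lws =>
      (compare kvs.length lws.length).then
        ((Val.cmpPairs kvs lws).1.then (Val.cmpPairs kvs lws).2)
  | .cons v v', .cons w w' => (v.cmp w).then (v'.cmp w')
  | v, w => compare v.rank w.rank

/-- Lexicographic comparison of lists of values. -/
def Val.cmpList : List Val → List Val → Ordering
  | v :: vs, w :: ws => (v.cmp w).then (Val.cmpList vs ws)
  | _, _ => .eq

/-- Lexicographic comparisons of the keys and of the values of two maps. -/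
def Val.cmpPairs : List (Val × Val) → List (Val × Val) → Ordering × Ordering
  | (k, v) :: kvs, (l, w) :: lws =>
      ((k.cmp l).then (Val.cmpPairs kvs lws).1, (v.cmp w).then (Val.cmpPairs kvs lws).2)
  | _, _ => (.eq, .eq)

end

/-- Adding an entry to a list of entries sorted by keys, unless its key is already present. -/
def mapInsert (k v : Val) : List (Val × Val) → List (Val × Val)
  | [] => [(k, v)]
  | (k', v') :: m =>
      match k.cmp k' with
      | .lt => (k, v) :: (k', v') :: m
      | .eq => (k', v') :: m
      | .gt => (k', v') :: mapInsert k v m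

/-- The entries of a map: for duplicate keys only the last entry is kept, and, as maps have no
order of entries, the entries are listed in the order of their keys. -/
def makeMap : List (Val × Val) → List (Val × Val)
  | [] => []
  | (k, v) :: l => mapInsert k v (makeMap l)

/-- `[v₁, v₂, …, vₙ] ↦ [(v₁, v₂), …, (vₙ₋₁, vₙ)]` for even `n`. -/
def pairUp : List Val → Option (List (Val × Val))
  | [] => some []
  | [_] => none
  | k :: v :: l => (pairUp l).map fun m => (k, v) :: m

/-- The alternating list of keys and values. -/
def unpair : List (Exp × Exp) → List Exp
  | [] => []
  | (k, v) :: l => k :: v :: unpair l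

/-! ## Built-in functions -/

/-- The elements of a proper list. -/
def Val.toList : Val → Option (List Val)
  | .nil => some []
  | .cons v w => w.toList.map fun l => v :: l
  | _ => none

/-- The list value with given elements and given tail. -/
def Val.ofList (l : List Val) (tail : Val) : Val := l.foldr Val.cons tail

/-- Removing the first element that equals `v`. -/
def removeFirst (v : Val) : List Val → List Val
  | [] => []
  | w :: l => if v.cmp w = .eq then l else w :: removeFirst v l

/-- Truth values are atoms. -/
def Val.ofBool (b : Bool) : Val := .atom (if b then atTrue else atFalse)

/-- The truth value that an atom stands for. -/
def Val.toBool : Val → Option Bool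
  | .atom a => if a = atTrue then some true else if a = atFalse then some false else none
  | _ => none

/-- The result that consists of a single value. -/
def Redex.one (v : Val) : Redex := .vals [v]

/-- An exception of class `error`. -/
def Redex.error (reason : Atom) (details : Val) : Redex := .exc ⟨.error, .atom reason, details⟩

/-- Arithmetic shift to the left (to the right for negative `j`). -/
def shiftLeft (i j : ℤ) : ℤ :=
  if 0 ≤ j then i * 2 ^ j.toNat else i / 2 ^ (-j).toNat

/-- The built-in functions of the module `erlang`. -/
inductive Bif where
  | add | sub | mul | div | rem | abs | bsl | bsr | and | or | not | eq | ne | exactEq | exactNe | lt | le | gt | ge | append | subtract | length | hd | tl | tupleToList | listToTuple | tupleSize | element | setElement | mapSize | isInteger | isNumber | isAtom | isBoolean | isList | isTuple | isMap | isFunction | funInfo | error | exit | throw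

/-- The names of the built-in functions. -/
def bifTable : List (Atom × Bif) :=
  [([43], .add),
   ([45], .sub),
   ([42], .mul),
   ([100, 105, 118], .div),
   ([114, 101, 109], .rem),
   ([97, 98, 115], .abs),
   ([98, 115, 108], .bsl),
   ([98, 115, 114], .bsr),
   ([97, 110, 100], .and),
   ([111, 114], .or),
   ([110, 111, 116], .not),
   ([61, 61], .eq),
   ([47, 61], .ne),
   ([61, 58, 61], .exactEq),
   ([61, 47, 61], .exactNe),
   ([60], .lt),
   ([61, 60], .le),
   ([62], .gt),
   ([62, 61], .ge),
   ([43, 43], .append),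
   ([45, 45], .subtract),
   ([108, 101, 110, 103, 116, 104], .length),
   ([104, 100], .hd),
   ([116, 108], .tl),
   ([116, 117, 112, 108, 101, 95, 116, 111, 95, 108, 105, 115, 116], .tupleToList),
   ([108, 105, 115, 116, 95, 116, 111, 95, 116, 117, 112, 108, 101], .listToTuple),
   ([116, 117, 112, 108, 101, 95, 115, 105, 122, 101], .tupleSize),
   ([101, 108, 101, 109, 101, 110, 116], .element),
   ([115, 101, 116, 101, 108, 101, 109, 101, 110, 116], .setElement),
   ([109, 97, 112, 95, 115, 105, 122, 101], .mapSize),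
   ([105, 115, 95, 105, 110, 116, 101, 103, 101, 114], .isInteger),
   ([105, 115, 95, 110, 117, 109, 98, 101, 114], .isNumber),
   ([105, 115, 95, 97, 116, 111, 109], .isAtom),
   ([105, 115, 95, 98, 111, 111, 108, 101, 97, 110], .isBoolean),
   ([105, 115, 95, 108, 105, 115, 116], .isList),
   ([105, 115, 95, 116, 117, 112, 108, 101], .isTuple),
   ([105, 115, 95, 109, 97, 112], .isMap),
   ([105, 115, 95, 102, 117, 110, 99, 116, 105, 111, 110], .isFunction),
   ([102, 117, 110, 95, 105, 110, 102, 111], .funInfo),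
   ([101, 114, 114, 111, 114], .error),
   ([101, 120, 105, 116], .exit),
   ([116, 104, 114, 111, 119], .throw)]

/-- The arities with which a built-in function is defined. -/
def Bif.arities : Bif → List ℕ
  | .add | .sub => [1, 2]
  | .abs | .not | .length | .hd | .tl | .tupleToList | .listToTuple | .tupleSize | .mapSize
  | .isInteger | .isNumber | .isAtom | .isBoolean | .isList | .isTuple | .isMap
  | .exit | .throw => [1]
  | .isFunction | .error => [1, 2]
  | .setElement => [3]
  | _ => [2]

/-- The reason of the exception that is raised for arguments outside the domain. -/
def Bif.badReason : Bif → Atom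
  | .add | .sub | .mul | .div | .rem | .bsl | .bsr => atBadarith
  | _ => atBadarg

/-- The result of a built-in function on arguments in its domain. -/
def Bif.run : Bif → List Val → Option Redex
  | .add, [.int i] => some (.one (.int i))
  | .add, [.int i, .int j] => some (.one (.int (i + j)))
  | .sub, [.int i] => some (.one (.int (-i)))
  | .sub, [.int i, .int j] => some (.one (.int (i - j)))
  | .mul, [.int i, .int j] => some (.one (.int (i * j)))
  | .div, [.int i, .int j] => if j = 0 then none else some (.one (.int (i.tdiv j)))
  | .rem, [.int i, .int j] => if j = 0 then none else some (.one (.int (i.tmod j)))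
  | .abs, [.int i] => some (.one (.int |i|))
  | .bsl, [.int i, .int j] => some (.one (.int (shiftLeft i j)))
  | .bsr, [.int i, .int j] => some (.one (.int (shiftLeft i (-j))))
  | .and, [v, w] => v.toBool.bind fun a => w.toBool.map fun b => .one (.ofBool (a && b))
  | .or, [v, w] => v.toBool.bind fun a => w.toBool.map fun b => .one (.ofBool (a || b))
  | .not, [v] => v.toBool.map fun a => .one (.ofBool !a)
  | .eq, [v, w] => some (.one (.ofBool (v.cmp w).isEq))
  | .ne, [v, w] => some (.one (.ofBool (v.cmp w).isNe))
  | .exactEq, [v, w] => some (.one (.ofBool (v.cmp w).isEq))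
  | .exactNe, [v, w] => some (.one (.ofBool (v.cmp w).isNe))
  | .lt, [v, w] => some (.one (.ofBool (v.cmp w).isLT))
  | .le, [v, w] => some (.one (.ofBool (v.cmp w).isLE))
  | .gt, [v, w] => some (.one (.ofBool (v.cmp w).isGT))
  | .ge, [v, w] => some (.one (.ofBool (v.cmp w).isGE))
  | .append, [v, w] => v.toList.map fun l => .one (.ofList l w)
  | .subtract, [v, w] => v.toList.bind fun l => w.toList.map fun l' =>
      .one (.ofList (l'.foldl (fun acc x => removeFirst x acc) l) .nil)
  | .length, [v] => v.toList.map fun l => .one (.int l.length)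
  | .hd, [.cons v _] => some (.one v)
  | .tl, [.cons _ w] => some (.one w)
  | .tupleToList, [.tuple vs] => some (.one (.ofList vs .nil))
  | .listToTuple, [v] => v.toList.map fun l => .one (.tuple l)
  | .tupleSize, [.tuple vs] => some (.one (.int vs.length))
  | .element, [.int i, .tuple vs] =>
      if 1 ≤ i then (vs[(i - 1).toNat]?).map fun v => .one v else none
  | .setElement, [.int i, .tuple vs, v] =>
      if 1 ≤ i ∧ i ≤ vs.length then some (.one (.tuple (vs.set (i - 1).toNat v))) else none
  | .mapSize, [.map kvs] => some (.one (.int kvs.length))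
  | .isInteger, [v] => some (.one (.ofBool (v.rank == 0)))
  | .isNumber, [v] => some (.one (.ofBool (v.rank == 0)))
  | .isAtom, [v] => some (.one (.ofBool (v.rank == 1)))
  | .isBoolean, [v] => some (.one (.ofBool v.toBool.isSome))
  | .isList, [v] => some (.one (.ofBool (v.rank == 5 || v.rank == 6)))
  | .isTuple, [v] => some (.one (.ofBool (v.rank == 3)))
  | .isMap, [v] => some (.one (.ofBool (v.rank == 4)))
  | .isFunction, [v] => some (.one (.ofBool (v.rank == 2)))
  | .isFunction, [.clos _ xs _, .int i] =>
      if 0 ≤ i then some (.one (.ofBool ((xs.length : ℤ) == i))) else none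
  | .isFunction, [_, .int i] => if 0 ≤ i then some (.one (.ofBool false)) else none
  | .funInfo, [.clos _ xs _, .atom a] =>
      if a = atArity then some (.one (.tuple [.atom atArity, .int xs.length])) else none
  | .error, [v] => some (.exc ⟨.error, v, .nil⟩)
  | .error, [v, w] => some (.exc ⟨.error, v, w⟩)
  | .exit, [v] => some (.exc ⟨.exit, v, .nil⟩)
  | .throw, [v] => some (.exc ⟨.throw, v, .nil⟩)
  | _, _ => none

/-- The result of calling the function `f` of the module `m`. A function that is not defined with
this arity raises `undef`, and arguments outside the domain raise `badarg` or `badarith`. -/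
def evalCall (m f : Atom) (vs : List Val) : Redex :=
  match (if m = atErlang then bifTable.lookup f else none) with
  | none => .error atUndef (.tuple [.atom m, .atom f, .int vs.length])
  | some b =>
      if vs.length ∈ b.arities then
        (b.run vs).getD (.error b.badReason (.tuple (.atom f :: vs)))
      else .error atUndef (.tuple [.atom m, .atom f, .int vs.length])

/-- The result of a primitive operation: `match_fail` raises its argument as an error. -/
def evalPrimop (a : Atom) (vs : List Val) : Redex :=
  if a = atMatchFail then
    match vs with
    | [v] => .exc ⟨.error, v, .nil⟩
    | _ => .error atUndef (.tuple [.atom a, .int vs.length])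
  else .error atUndef (.tuple [.atom a, .int vs.length])

/-- The redex `eval(id, v₁, …, vₙ)` built from a frame identifier and evaluated parameters; it is
undefined only for a map with an odd number of parameters. -/
noncomputable def eval : FrameId → List Val → Option Redex
  | .app (.clos ext xs e), vs =>
      if vs.length = xs.length then
        some (.exp (e.subst ((mkClosList ext).union (.ofVars xs vs))))
      else some (.error atBadarity (.clos ext xs e))
  | .app v, _ => some (.error atBadfun v)
  | .tuple, vs => some (.one (.tuple vs))
  | .values, vs => some (.vals vs)
  | .map, vs => (pairUp vs).map fun l => .one (.map (makeMap l))
  | .call (.atom m) (.atom f), vs => some (evalCall m f vs)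
  | .call vm vf, _ => some (.error atBadarg (.tuple [vm, vf]))
  | .primop a, vs => some (evalPrimop a vs)

/-! ## Dynamic semantics -/

/-- Exception handlers. -/
def Frame.IsTry : Frame → Prop
  | .tryOf _ _ _ _ => True
  | _ => False

/-- The reduction relation `⟨K, r⟩ ⟶ ⟨K', r'⟩`. -/
inductive Step : FrameStack → Redex → FrameStack → Redex → Prop
  -- Extracting the first redex of an expression.
  | sConsTail (K e₁ e₂) :
      Step K (.exp (.nonval (.cons e₁ e₂))) (.consTail e₁ :: K) (.exp e₂)
  | sLet (K xs e₁ e₂) :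
      Step K (.exp (.nonval (.letIn xs e₁ e₂))) (.letIn xs e₂ :: K) (.exp e₁)
  | sSeq (K e₁ e₂) :
      Step K (.exp (.nonval (.seq e₁ e₂))) (.seq e₂ :: K) (.exp e₁)
  | sApp (K e es) :
      Step K (.exp (.nonval (.apply e es))) (.apply es :: K) (.exp e)
  | sCallMod (K em ef es) :
      Step K (.exp (.nonval (.call em ef es))) (.callMod ef es :: K) (.exp em)
  | sPrimOp (K a es) :
      Step K (.exp (.nonval (.primop a es))) (.params (.primop a) [] es :: K) .box
  | sVals (K es) :
      Step K (.exp (.nonval (.values es))) (.params .values [] es :: K) .box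
  | sTuple (K es) :
      Step K (.exp (.nonval (.tuple es))) (.params .tuple [] es :: K) .box
  | sMap (K ek ev kvs) :
      Step K (.exp (.nonval (.map ((ek, ev) :: kvs))))
        (.params .map [] (ev :: unpair kvs) :: K) (.exp ek)
  | sCase (K e cls) :
      Step K (.exp (.nonval (.case e cls))) (.caseOf cls :: K) (.exp e)
  | sTry (K e₁ xs e₂ ys e₃) :
      Step K (.exp (.nonval (.tryOf e₁ xs e₂ ys e₃))) (.tryOf xs e₂ ys e₃ :: K) (.exp e₁)
  -- Modifying the top frame of the stack.
  | sConsHead (K e₁ v₂) :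
      Step (.consTail e₁ :: K) (.vals [v₂]) (.consHead v₂ :: K) (.exp e₁)
  | sCallFun (K ef es vm) :
      Step (.callMod ef es :: K) (.vals [vm]) (.callFun vm es :: K) (.exp ef)
  | sCallParam (K vm es vf) :
      Step (.callFun vm es :: K) (.vals [vf]) (.params (.call vm vf) [] es :: K) .box
  | sAppParam (K es v) :
      Step (.apply es :: K) (.vals [v]) (.params (.app v) [] es :: K) .box
  | sCaseFail (K ps g b cls vs) (h : Pat.matchList ps vs = none) :
      Step (.caseOf (.mk ps g b :: cls) :: K) (.vals vs) (.caseOf cls :: K) (.vals vs)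
  | sCaseSuccess (K ps g b cls vs l) (h : Pat.matchList ps vs = some l) :
      Step (.caseOf (.mk ps g b :: cls) :: K) (.vals vs)
        (.caseGuard vs ps (b.subst (.ofBindings l)) cls :: K) (.exp (g.subst (.ofBindings l)))
  | sCaseFalse (K vs ps b cls) :
      Step (.caseGuard vs ps b cls :: K) (.vals [.atom atFalse]) (.caseOf cls :: K) (.vals vs)
  | sParams₀ (K id e es) (h : id ≠ .map) :
      Step (.params id [] (e :: es) :: K) .box (.params id [] es :: K) (.exp e)
  | sParams (K id vs v e es) :
      Step (.params id vs (e :: es) :: K) (.vals [v]) (.params id (vs ++ [v]) es :: K) (.exp e)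
  -- Removing the top frame, and reductions that do not touch the stack.
  | pMap₀ (K) :
      Step K (.exp (.nonval (.map []))) K (.vals [.map []])
  | pFun (K xs e) :
      Step K (.exp (.nonval (.lam xs e))) K (.vals [.clos [] xs e])
  | pLetRec (K ext e) :
      Step K (.exp (.nonval (.letrec ext e))) K (.exp (e.subst (mkClosList ext)))
  | pValue (K v) :
      Step K (.exp (.val v)) K (.vals [v])
  | pParams₀ (K id vs r) (h : id ≠ .map) (hr : eval id vs = some r) :
      Step (.params id vs [] :: K) .box K r
  | pParams (K id vs v r) (hr : eval id (vs ++ [v]) = some r) :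
      Step (.params id vs [] :: K) (.vals [v]) K r
  | pCons (K v₁ v₂) :
      Step (.consHead v₂ :: K) (.vals [v₁]) K (.vals [.cons v₁ v₂])
  | pCaseTrue (K vs ps b cls) :
      Step (.caseGuard vs ps b cls :: K) (.vals [.atom atTrue]) K (.exp b)
  | pLet (K xs e₂ vs) (h : vs.length = xs.length) :
      Step (.letIn xs e₂ :: K) (.vals vs) K (.exp (e₂.subst (.ofVars xs vs)))
  | pSeq (K e₂ v) :
      Step (.seq e₂ :: K) (.vals [v]) K (.exp e₂)
  | pTry (K xs e₂ ys e₃ vs) (h : vs.length = xs.length) :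
      Step (.tryOf xs e₂ ys e₃ :: K) (.vals vs) K (.exp (e₂.subst (.ofVars xs vs)))
  -- Exceptions.
  | excCase (K vs) :
      Step (.caseOf [] :: K) (.vals vs) K (.error atIfClause (.tuple []))
  | excTry (K xs e₂ y₁ y₂ y₃ e₃ x) :
      Step (.tryOf xs e₂ [y₁, y₂, y₃] e₃ :: K) (.exc x) K
        (.exp (e₃.subst (.ofVars [y₁, y₂, y₃] [.atom x.cls.toAtom, x.reason, x.details])))
  | excProp (K F x) (h : ¬ F.IsTry) :
      Step (F :: K) (.exc x) K (.exc x)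

/-- `⟨K, r⟩ ⟶ⁿ ⟨K', r'⟩`. -/
inductive StepN : ℕ → FrameStack → Redex → FrameStack → Redex → Prop
  | refl (K r) : StepN 0 K r K r
  | head {n K₁ r₁ K₂ r₂ K₃ r₃} (h : Step K₁ r₁ K₂ r₂) (t : StepN n K₂ r₂ K₃ r₃) :
      StepN (n + 1) K₁ r₁ K₃ r₃

/-- `⟨K, r⟩ ⇓ⁿ`: in `n` steps, `r` reaches a result in the empty frame stack. -/
def TermIn (K : FrameStack) (r : Redex) (n : ℕ) : Prop :=
  ∃ res : Redex, res.IsResult ∧ StepN n K r [] res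

/-- `⟨K, r⟩ ⇓`. -/
def Term (K : FrameStack) (r : Redex) : Prop := ∃ n, TermIn K r n

/-- The CIU preorder on redexes. -/
def CIU (r₁ r₂ : Redex) : Prop :=
  r₁.Closed ∧ r₂.Closed ∧ ∀ K : FrameStack, K.Closed → Term K r₁ → Term K r₂

/-! ## Step-indexed logical relations on closed values, exceptions, frame stacks, expressions

The relations are parametrised by a family `V` of relations on values; `VRel` ties the knot. -/

/-- Related exceptions. -/
def XRelOf (V : Val → Val → Prop) (x₁ x₂ : Exc) : Prop :=
  x₁.cls = x₂.cls ∧ V x₁.reason x₂.reason ∧ V x₁.details x₂.details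

/-- Related frame stacks. -/
def KRelOf (V : ℕ → Val → Val → Prop) (n : ℕ) (K₁ K₂ : FrameStack) : Prop :=
  K₁.Closed ∧ K₂.Closed ∧
  (∀ m ≤ n, ∀ vs₁ vs₂ : List Val, List.Forall₂ (V m) vs₁ vs₂ →
    TermIn K₁ (.vals vs₁) m → Term K₂ (.vals vs₂)) ∧
  (∀ m ≤ n, ∀ x₁ x₂ : Exc, XRelOf (V m) x₁ x₂ →
    TermIn K₁ (.exc x₁) m → Term K₂ (.exc x₂)) ∧
  (∀ m ≤ n, TermIn K₁ .box m → Term K₂ .box)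

/-- Related expressions. -/
def ERelOf (V : ℕ → Val → Val → Prop) (n : ℕ) (e₁ e₂ : Exp) : Prop :=
  e₁.Closed ∧ e₂.Closed ∧
  ∀ m ≤ n, ∀ K₁ K₂ : FrameStack, KRelOf V m K₁ K₂ →
    TermIn K₁ (.exp e₁) m → Term K₂ (.exp e₂)

/-- The condition on two closures `clos(ext, xs, e)` and `clos(ext', ys, e')`: they have the same
number of parameters (whose names are irrelevant), and the bodies are related for related
arguments at all smaller indices. -/
def ClosRelOf (V : ℕ → Val → Val → Prop) (n : ℕ)
    (ext : List ClosItem) (xs : List Var) (e : Exp)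
    (ext' : List ClosItem) (ys : List Var) (e' : Exp) : Prop :=
  xs.length = ys.length ∧
  ∀ m < n, ∀ vs vs' : List Val, vs.length = xs.length → List.Forall₂ (V m) vs vs' →
    ERelOf V m (e.subst ((mkClosList ext).union (.ofVars xs vs)))
      (e'.subst ((mkClosList ext').union (.ofVars ys vs')))

mutual

/-- Structural lifting of the condition on closures to values. -/
def Val.RelOf (V : ℕ → Val → Val → Prop) (n : ℕ) : Val → Val → Prop
  | .int i, .int j => i = j
  | .atom a, .atom b => a = b
  | .nil, .nil => True
  | .cons v w, .cons v' w' => Val.RelOf V n v v' ∧ Val.RelOf V n w w'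
  | .tuple vs, .tuple vs' => Val.RelOfList V n vs vs'
  | .map kvs, .map kvs' => Val.RelOfPairs V n kvs kvs'
  | .clos ext xs e, .clos ext' ys e' => ClosRelOf V n ext xs e ext' ys e'
  | _, _ => False

/-- Element-wise lifting to lists. -/
def Val.RelOfList (V : ℕ → Val → Val → Prop) (n : ℕ) : List Val → List Val → Prop
  | [], [] => True
  | v :: vs, v' :: vs' => Val.RelOf V n v v' ∧ Val.RelOfList V n vs vs'
  | _, _ => False

/-- Element-wise lifting to the entries of maps. -/
def Val.RelOfPairs (V : ℕ → Val → Val → Prop) (n : ℕ) :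
    List (Val × Val) → List (Val × Val) → Prop
  | [], [] => True
  | (k, v) :: kvs, (k', v') :: kvs' =>
      Val.RelOf V n k k' ∧ Val.RelOf V n v v' ∧ Val.RelOfPairs V n kvs kvs'
  | _, _ => False

end

/-- `(v₁, v₂) ∈ 𝕍ₙ`, by recursion on `n`: the defining condition at `n` refers to `𝕍ₘ` only for
`m < n`. The equation without the bound on `m` is `VRel_iff`. -/
def VRel (n : ℕ) (v₁ v₂ : Val) : Prop :=
  v₁.Closed ∧ v₂.Closed ∧ Val.RelOf (fun m w₁ w₂ => ∃ _ : m < n, VRel m w₁ w₂) n v₁ v₂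
termination_by n

/-- `(x₁, x₂) ∈ 𝕏ₙ`. -/
def XRel (n : ℕ) : Exc → Exc → Prop := XRelOf (VRel n)

/-- `(K₁, K₂) ∈ 𝕂ₙ`. -/
def KRel (n : ℕ) : FrameStack → FrameStack → Prop := KRelOf VRel n

/-- `(e₁, e₂) ∈ 𝔼ₙ`. -/
def ERel (n : ℕ) : Exp → Exp → Prop := ERelOf VRel n

theorem KRelOf_congr {V W : ℕ → Val → Val → Prop} {n : ℕ} (h : ∀ m ≤ n, V m = W m) :
    KRelOf V n = KRelOf W n := by
  funext K₁ K₂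
  simp +contextual only [KRelOf, h]

theorem ERelOf_congr {V W : ℕ → Val → Val → Prop} {n : ℕ} (h : ∀ m ≤ n, V m = W m) :
    ERelOf V n = ERelOf W n := by
  funext e₁ e₂
  have hk : ∀ m ≤ n, KRelOf V m = KRelOf W m := fun m hm =>
    KRelOf_congr fun k hk => h k (hk.trans hm)
  simp +contextual only [ERelOf, hk]

theorem ClosRelOf_congr {V W : ℕ → Val → Val → Prop} {n : ℕ} (h : ∀ m < n, V m = W m) :
    ClosRelOf V n = ClosRelOf W n := by
  funext ext xs e ext' ys e'
  have he : ∀ m < n, ERelOf V m = ERelOf W m := fun m hm =>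
    ERelOf_congr fun k hk => h k (hk.trans_lt hm)
  simp +contextual only [ClosRelOf, h, he]

mutual

theorem RelOf_congr {V W : ℕ → Val → Val → Prop} {n : ℕ} (h : ∀ m < n, V m = W m) :
    ∀ v w : Val, Val.RelOf V n v w ↔ Val.RelOf W n v w
  | .int _, w => by cases w <;> simp [Val.RelOf]
  | .atom _, w => by cases w <;> simp [Val.RelOf]
  | .var _, w => by cases w <;> simp [Val.RelOf]
  | .fid _ _, w => by cases w <;> simp [Val.RelOf]
  | .clos _ _ _, w => by cases w <;> simp [Val.RelOf, ClosRelOf_congr h]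
  | .cons v v', w => by
      cases w <;> simp [Val.RelOf, RelOf_congr h v, RelOf_congr h v']
  | .nil, w => by cases w <;> simp [Val.RelOf]
  | .tuple vs, w => by cases w <;> simp [Val.RelOf, RelOfList_congr h vs]
  | .map kvs, w => by cases w <;> simp [Val.RelOf, RelOfPairs_congr h kvs]

theorem RelOfList_congr {V W : ℕ → Val → Val → Prop} {n : ℕ} (h : ∀ m < n, V m = W m) :
    ∀ vs ws : List Val, Val.RelOfList V n vs ws ↔ Val.RelOfList W n vs ws
  | [], ws => by cases ws <;> simp [Val.RelOfList]
  | v :: vs, ws => by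
      cases ws <;> simp [Val.RelOfList, RelOf_congr h v, RelOfList_congr h vs]

theorem RelOfPairs_congr {V W : ℕ → Val → Val → Prop} {n : ℕ} (h : ∀ m < n, V m = W m) :
    ∀ vs ws : List (Val × Val), Val.RelOfPairs V n vs ws ↔ Val.RelOfPairs W n vs ws
  | [], ws => by cases ws <;> simp [Val.RelOfPairs]
  | (k, v) :: vs, ws => by
      cases ws <;>
        simp [Val.RelOfPairs, RelOf_congr h k, RelOf_congr h v, RelOfPairs_congr h vs]

end

/-- The defining equation of the relations `𝕍ₙ`. -/
theorem VRel_iff (n : ℕ) (v₁ v₂ : Val) :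
    VRel n v₁ v₂ ↔ v₁.Closed ∧ v₂.Closed ∧ Val.RelOf VRel n v₁ v₂ := by
  have h : ∀ m < n, (fun m w₁ w₂ => ∃ _ : m < n, VRel m w₁ w₂) m = VRel m := fun m hm => by
    funext w₁ w₂
    simp [hm]
  rw [VRel, RelOf_congr h]

end CoreErlang

namespace CoreErlang

/-! ## Scoping and substitution -/

mutual

theorem Val.Scoped.mono : ∀ {v : Val} {Γ Δ : Set Name}, Γ ⊆ Δ → v.Scoped Γ → v.Scoped Δ
  | .int _, _, _, _, h => h
  | .atom _, _, _, _, h => h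
  | .var _, _, _, hs, h => hs h
  | .fid _ _, _, _, hs, h => hs h
  | .clos _ _ _, _, _, hs, ⟨h₁, h₂⟩ =>
      ⟨ClosItem.ScopedAll.mono (Set.union_subset_union_left _ hs) h₁,
        h₂.mono (Set.union_subset_union_left _ (Set.union_subset_union_left _ hs))⟩
  | .cons _ _, _, _, hs, ⟨h₁, h₂⟩ => ⟨h₁.mono hs, h₂.mono hs⟩
  | .nil, _, _, _, h => h
  | .tuple vs, _, _, hs, h => Val.ScopedAll.mono (vs := vs) hs h
  | .map kvs, _, _, hs, h => Val.ScopedPairs.mono (kvs := kvs) hs h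

theorem Val.ScopedAll.mono : ∀ {vs : List Val} {Γ Δ : Set Name}, Γ ⊆ Δ →
    Val.ScopedAll vs Γ → Val.ScopedAll vs Δ
  | [], _, _, _, h => h
  | _ :: _, _, _, hs, ⟨h₁, h₂⟩ => ⟨h₁.mono hs, Val.ScopedAll.mono hs h₂⟩

theorem Val.ScopedPairs.mono : ∀ {kvs : List (Val × Val)} {Γ Δ : Set Name}, Γ ⊆ Δ →
    Val.ScopedPairs kvs Γ → Val.ScopedPairs kvs Δ
  | [], _, _, _, h => h
  | (_, _) :: _, _, _, hs, ⟨h₁, h₂, h₃⟩ =>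
      ⟨h₁.mono hs, h₂.mono hs, Val.ScopedPairs.mono hs h₃⟩

theorem ClosItem.ScopedAll.mono : ∀ {ext : List ClosItem} {Γ Δ : Set Name}, Γ ⊆ Δ →
    ClosItem.ScopedAll ext Γ → ClosItem.ScopedAll ext Δ
  | [], _, _, _, h => h
  | .mk _ _ _ :: _, _, _, hs, ⟨h₁, h₂⟩ =>
      ⟨h₁.mono (Set.union_subset_union_left _ hs), ClosItem.ScopedAll.mono hs h₂⟩

theorem Clause.ScopedAll.mono : ∀ {cls : List Clause} {Γ Δ : Set Name}, Γ ⊆ Δ →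
    Clause.ScopedAll cls Γ → Clause.ScopedAll cls Δ
  | [], _, _, _, h => h
  | .mk _ _ _ :: _, _, _, hs, ⟨h₁, h₂, h₃⟩ =>
      ⟨h₁.mono (Set.union_subset_union_left _ hs), h₂.mono (Set.union_subset_union_left _ hs),
        Clause.ScopedAll.mono hs h₃⟩

theorem NonVal.Scoped.mono : ∀ {n : NonVal} {Γ Δ : Set Name}, Γ ⊆ Δ → n.Scoped Γ → n.Scoped Δ
  | .lam _ e, _, _, hs, h => Exp.Scoped.mono (e := e) (Set.union_subset_union_left _ hs) h
  | .values es, _, _, hs, h => Exp.ScopedAll.mono (es := es) hs h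
  | .cons _ _, _, _, hs, ⟨h₁, h₂⟩ => ⟨h₁.mono hs, h₂.mono hs⟩
  | .tuple es, _, _, hs, h => Exp.ScopedAll.mono (es := es) hs h
  | .map kvs, _, _, hs, h => Exp.ScopedPairs.mono (kvs := kvs) hs h
  | .call _ _ _, _, _, hs, ⟨h₁, h₂, h₃⟩ =>
      ⟨h₁.mono hs, h₂.mono hs, Exp.ScopedAll.mono hs h₃⟩
  | .primop _ es, _, _, hs, h => Exp.ScopedAll.mono (es := es) hs h
  | .apply _ _, _, _, hs, ⟨h₁, h₂⟩ => ⟨h₁.mono hs, Exp.ScopedAll.mono hs h₂⟩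
  | .case _ _, _, _, hs, ⟨h₁, h₂⟩ => ⟨h₁.mono hs, Clause.ScopedAll.mono hs h₂⟩
  | .letIn _ _ _, _, _, hs, ⟨h₁, h₂⟩ =>
      ⟨h₁.mono hs, h₂.mono (Set.union_subset_union_left _ hs)⟩
  | .seq _ _, _, _, hs, ⟨h₁, h₂⟩ => ⟨h₁.mono hs, h₂.mono hs⟩
  | .letrec _ _, _, _, hs, ⟨h₁, h₂⟩ =>
      ⟨ClosItem.ScopedAll.mono (Set.union_subset_union_left _ hs) h₁,
        h₂.mono (Set.union_subset_union_left _ hs)⟩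
  | .tryOf _ _ _ _ _, _, _, hs, ⟨h₁, h₂, h₃⟩ =>
      ⟨h₁.mono hs, h₂.mono (Set.union_subset_union_left _ hs),
        h₃.mono (Set.union_subset_union_left _ hs)⟩

theorem Exp.Scoped.mono : ∀ {e : Exp} {Γ Δ : Set Name}, Γ ⊆ Δ → e.Scoped Γ → e.Scoped Δ
  | .nonval n, _, _, hs, h => NonVal.Scoped.mono (n := n) hs h
  | .val v, _, _, hs, h => Val.Scoped.mono (v := v) hs h

theorem Exp.ScopedAll.mono : ∀ {es : List Exp} {Γ Δ : Set Name}, Γ ⊆ Δ →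
    Exp.ScopedAll es Γ → Exp.ScopedAll es Δ
  | [], _, _, _, h => h
  | _ :: _, _, _, hs, ⟨h₁, h₂⟩ => ⟨h₁.mono hs, Exp.ScopedAll.mono hs h₂⟩

theorem Exp.ScopedPairs.mono : ∀ {kvs : List (Exp × Exp)} {Γ Δ : Set Name}, Γ ⊆ Δ →
    Exp.ScopedPairs kvs Γ → Exp.ScopedPairs kvs Δ
  | [], _, _, _, h => h
  | (_, _) :: _, _, _, hs, ⟨h₁, h₂, h₃⟩ =>
      ⟨h₁.mono hs, h₂.mono hs, Exp.ScopedPairs.mono hs h₃⟩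

end

@[simp] theorem namesOf_substAll (ext : List ClosItem) (σ : Subst) :
    namesOf (ClosItem.substAll ext σ) = namesOf ext := by
  induction ext with
  | nil => simp [ClosItem.substAll]
  | cons c ext ih =>
    obtain ⟨f, xs, e⟩ := c
    have h : ∀ (c : ClosItem) (l : List ClosItem), namesOf (c :: l) = {c.name} ∪ namesOf l := by
      intro c l
      ext y
      simp [namesOf]
    rw [ClosItem.substAll, h, h, ih]
    rfl

/-- Names in `Γ` are either replaced by closed values, or left unchanged and in `Δ`. -/
def Subst.Maps (σ : Subst) (Γ Δ : Set Name) : Prop :=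
  (∀ y v, σ y = some v → v.Closed) ∧ ∀ y ∈ Γ, σ y = none → y ∈ Δ

theorem Subst.Maps.erase {σ : Subst} {Γ Δ : Set Name} (h : σ.Maps Γ Δ) (s : Set Name) :
    (σ.erase s).Maps (Γ ∪ s) (Δ ∪ s) := by
  refine ⟨fun y v hv => ?_, fun y hy hn => ?_⟩
  · by_cases hs : y ∈ s
    · simp [Subst.erase, hs] at hv
    · exact h.1 y v (by simpa [Subst.erase, hs] using hv)
  · by_cases hs : y ∈ s
    · exact Or.inr hs
    · exact Or.inl (h.2 y (hy.resolve_right hs) (by simpa [Subst.erase, hs] using hn))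

mutual

theorem Val.Scoped.subst : ∀ {v : Val} {σ : Subst} {Γ Δ : Set Name}, σ.Maps Γ Δ →
    v.Scoped Γ → (v.subst σ).Scoped Δ
  | .int _, _, _, _, _, _ => trivial
  | .atom _, _, _, _, _, _ => trivial
  | .var x, σ, _, _, hs, h => by
      rw [Val.subst]
      cases hx : σ (.var x) with
      | none => exact hs.2 _ h hx
      | some v => exact (hs.1 _ v hx).mono (Set.empty_subset _)
  | .fid f k, σ, _, _, hs, h => by
      rw [Val.subst]
      cases hx : σ (.fid f k) with
      | none => exact hs.2 _ h hx
      | some v => exact (hs.1 _ v hx).mono (Set.empty_subset _)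
  | .clos ext xs e, _, _, _, hs, ⟨h₁, h₂⟩ => by
      rw [Val.subst, Val.Scoped, namesOf_substAll]
      refine ⟨ClosItem.ScopedAll.subst (hs.erase _) h₁, Exp.Scoped.subst (e := e) ?_ h₂⟩
      rw [Set.union_assoc, Set.union_assoc]
      exact hs.erase _
  | .cons v w, _, _, _, hs, ⟨h₁, h₂⟩ => ⟨Val.Scoped.subst hs h₁, Val.Scoped.subst hs h₂⟩
  | .nil, _, _, _, _, _ => trivial
  | .tuple vs, _, _, _, hs, h => Val.ScopedAll.subst (vs := vs) hs h
  | .map kvs, _, _, _, hs, h => Val.ScopedPairs.subst (kvs := kvs) hs h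

theorem Val.ScopedAll.subst : ∀ {vs : List Val} {σ : Subst} {Γ Δ : Set Name}, σ.Maps Γ Δ →
    Val.ScopedAll vs Γ → Val.ScopedAll (Val.substAll vs σ) Δ
  | [], _, _, _, _, _ => trivial
  | _ :: _, _, _, _, hs, ⟨h₁, h₂⟩ => ⟨Val.Scoped.subst hs h₁, Val.ScopedAll.subst hs h₂⟩

theorem Val.ScopedPairs.subst : ∀ {kvs : List (Val × Val)} {σ : Subst} {Γ Δ : Set Name},
    σ.Maps Γ Δ → Val.ScopedPairs kvs Γ → Val.ScopedPairs (Val.substPairs kvs σ) Δ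
  | [], _, _, _, _, _ => trivial
  | (_, _) :: _, _, _, _, hs, ⟨h₁, h₂, h₃⟩ =>
      ⟨Val.Scoped.subst hs h₁, Val.Scoped.subst hs h₂, Val.ScopedPairs.subst hs h₃⟩

theorem ClosItem.ScopedAll.subst : ∀ {ext : List ClosItem} {σ : Subst} {Γ Δ : Set Name},
    σ.Maps Γ Δ → ClosItem.ScopedAll ext Γ → ClosItem.ScopedAll (ClosItem.substAll ext σ) Δ
  | [], _, _, _, _, _ => trivial
  | .mk _ _ _ :: _, _, _, _, hs, ⟨h₁, h₂⟩ =>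
      ⟨Exp.Scoped.subst (hs.erase _) h₁, ClosItem.ScopedAll.subst hs h₂⟩

theorem Clause.ScopedAll.subst : ∀ {cls : List Clause} {σ : Subst} {Γ Δ : Set Name},
    σ.Maps Γ Δ → Clause.ScopedAll cls Γ → Clause.ScopedAll (Clause.substAll cls σ) Δ
  | [], _, _, _, _, _ => trivial
  | .mk _ _ _ :: _, _, _, _, hs, ⟨h₁, h₂, h₃⟩ =>
      ⟨Exp.Scoped.subst (hs.erase _) h₁, Exp.Scoped.subst (hs.erase _) h₂,
        Clause.ScopedAll.subst hs h₃⟩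

theorem NonVal.Scoped.subst : ∀ {n : NonVal} {σ : Subst} {Γ Δ : Set Name}, σ.Maps Γ Δ →
    n.Scoped Γ → (n.subst σ).Scoped Δ
  | .lam _ e, _, _, _, hs, h => Exp.Scoped.subst (e := e) (hs.erase _) h
  | .values es, _, _, _, hs, h => Exp.ScopedAll.subst (es := es) hs h
  | .cons _ _, _, _, _, hs, ⟨h₁, h₂⟩ => ⟨Exp.Scoped.subst hs h₁, Exp.Scoped.subst hs h₂⟩
  | .tuple es, _, _, _, hs, h => Exp.ScopedAll.subst (es := es) hs h
  | .map kvs, _, _, _, hs, h => Exp.ScopedPairs.subst (kvs := kvs) hs h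
  | .call _ _ _, _, _, _, hs, ⟨h₁, h₂, h₃⟩ =>
      ⟨Exp.Scoped.subst hs h₁, Exp.Scoped.subst hs h₂, Exp.ScopedAll.subst hs h₃⟩
  | .primop _ es, _, _, _, hs, h => Exp.ScopedAll.subst (es := es) hs h
  | .apply _ _, _, _, _, hs, ⟨h₁, h₂⟩ => ⟨Exp.Scoped.subst hs h₁, Exp.ScopedAll.subst hs h₂⟩
  | .case _ _, _, _, _, hs, ⟨h₁, h₂⟩ => ⟨Exp.Scoped.subst hs h₁, Clause.ScopedAll.subst hs h₂⟩
  | .letIn _ _ _, _, _, _, hs, ⟨h₁, h₂⟩ =>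
      ⟨Exp.Scoped.subst hs h₁, Exp.Scoped.subst (hs.erase _) h₂⟩
  | .seq _ _, _, _, _, hs, ⟨h₁, h₂⟩ => ⟨Exp.Scoped.subst hs h₁, Exp.Scoped.subst hs h₂⟩
  | .letrec ext e, _, _, _, hs, ⟨h₁, h₂⟩ => by
      rw [NonVal.subst, NonVal.Scoped, namesOf_substAll]
      exact ⟨ClosItem.ScopedAll.subst (hs.erase _) h₁, Exp.Scoped.subst (hs.erase _) h₂⟩
  | .tryOf _ _ _ _ _, _, _, _, hs, ⟨h₁, h₂, h₃⟩ =>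
      ⟨Exp.Scoped.subst hs h₁, Exp.Scoped.subst (hs.erase _) h₂,
        Exp.Scoped.subst (hs.erase _) h₃⟩

theorem Exp.Scoped.subst : ∀ {e : Exp} {σ : Subst} {Γ Δ : Set Name}, σ.Maps Γ Δ →
    e.Scoped Γ → (e.subst σ).Scoped Δ
  | .nonval n, _, _, _, hs, h => NonVal.Scoped.subst (n := n) hs h
  | .val v, _, _, _, hs, h => Val.Scoped.subst (v := v) hs h

theorem Exp.ScopedAll.subst : ∀ {es : List Exp} {σ : Subst} {Γ Δ : Set Name}, σ.Maps Γ Δ →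
    Exp.ScopedAll es Γ → Exp.ScopedAll (Exp.substAll es σ) Δ
  | [], _, _, _, _, _ => trivial
  | _ :: _, _, _, _, hs, ⟨h₁, h₂⟩ => ⟨Exp.Scoped.subst hs h₁, Exp.ScopedAll.subst hs h₂⟩

theorem Exp.ScopedPairs.subst : ∀ {kvs : List (Exp × Exp)} {σ : Subst} {Γ Δ : Set Name},
    σ.Maps Γ Δ → Exp.ScopedPairs kvs Γ → Exp.ScopedPairs (Exp.substPairs kvs σ) Δ
  | [], _, _, _, _, _ => trivial
  | (_, _) :: _, _, _, _, hs, ⟨h₁, h₂, h₃⟩ =>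
      ⟨Exp.Scoped.subst hs h₁, Exp.Scoped.subst hs h₂, Exp.ScopedPairs.subst hs h₃⟩

end

/-- `σ` leaves all names in `Γ` unchanged. -/
def Subst.Fixes (σ : Subst) (Γ : Set Name) : Prop := ∀ y ∈ Γ, σ y = none

theorem Subst.Fixes.erase {σ : Subst} {Γ : Set Name} (h : σ.Fixes Γ) (s : Set Name) :
    (σ.erase s).Fixes (Γ ∪ s) := by
  intro y hy
  by_cases hs : y ∈ s
  · simp [Subst.erase, hs]
  · simpa [Subst.erase, hs] using h y (hy.resolve_right hs)

mutual

theorem Val.Scoped.subst_eq : ∀ {v : Val} {σ : Subst} {Γ : Set Name}, σ.Fixes Γ →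
    v.Scoped Γ → v.subst σ = v
  | .int _, _, _, _, _ => rfl
  | .atom _, _, _, _, _ => rfl
  | .var x, σ, _, hs, h => by rw [Val.subst, hs _ h]; rfl
  | .fid f k, σ, _, hs, h => by rw [Val.subst, hs _ h]; rfl
  | .clos ext xs e, _, _, hs, ⟨h₁, h₂⟩ => by
      rw [Val.subst, ClosItem.ScopedAll.subst_eq (hs.erase _) h₁,
        Exp.Scoped.subst_eq (hs.erase _) (by rwa [← Set.union_assoc])]
  | .cons v w, _, _, hs, ⟨h₁, h₂⟩ => by
      rw [Val.subst, Val.Scoped.subst_eq hs h₁, Val.Scoped.subst_eq hs h₂]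
  | .nil, _, _, _, _ => rfl
  | .tuple vs, _, _, hs, h => by rw [Val.subst, Val.ScopedAll.subst_eq hs h]
  | .map kvs, _, _, hs, h => by rw [Val.subst, Val.ScopedPairs.subst_eq hs h]

theorem Val.ScopedAll.subst_eq : ∀ {vs : List Val} {σ : Subst} {Γ : Set Name}, σ.Fixes Γ →
    Val.ScopedAll vs Γ → Val.substAll vs σ = vs
  | [], _, _, _, _ => rfl
  | _ :: _, _, _, hs, ⟨h₁, h₂⟩ => by
      rw [Val.substAll, Val.Scoped.subst_eq hs h₁, Val.ScopedAll.subst_eq hs h₂]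

theorem Val.ScopedPairs.subst_eq : ∀ {kvs : List (Val × Val)} {σ : Subst} {Γ : Set Name},
    σ.Fixes Γ → Val.ScopedPairs kvs Γ → Val.substPairs kvs σ = kvs
  | [], _, _, _, _ => rfl
  | (_, _) :: _, _, _, hs, ⟨h₁, h₂, h₃⟩ => by
      rw [Val.substPairs, Val.Scoped.subst_eq hs h₁, Val.Scoped.subst_eq hs h₂,
        Val.ScopedPairs.subst_eq hs h₃]

theorem ClosItem.ScopedAll.subst_eq : ∀ {ext : List ClosItem} {σ : Subst} {Γ : Set Name},
    σ.Fixes Γ → ClosItem.ScopedAll ext Γ → ClosItem.substAll ext σ = ext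
  | [], _, _, _, _ => rfl
  | .mk _ _ _ :: _, _, _, hs, ⟨h₁, h₂⟩ => by
      rw [ClosItem.substAll, Exp.Scoped.subst_eq (hs.erase _) h₁,
        ClosItem.ScopedAll.subst_eq hs h₂]

theorem Clause.ScopedAll.subst_eq : ∀ {cls : List Clause} {σ : Subst} {Γ : Set Name},
    σ.Fixes Γ → Clause.ScopedAll cls Γ → Clause.substAll cls σ = cls
  | [], _, _, _, _ => rfl
  | .mk _ _ _ :: _, _, _, hs, ⟨h₁, h₂, h₃⟩ => by
      rw [Clause.substAll, Exp.Scoped.subst_eq (hs.erase _) h₁,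
        Exp.Scoped.subst_eq (hs.erase _) h₂, Clause.ScopedAll.subst_eq hs h₃]

theorem NonVal.Scoped.subst_eq : ∀ {n : NonVal} {σ : Subst} {Γ : Set Name}, σ.Fixes Γ →
    n.Scoped Γ → n.subst σ = n
  | .lam _ e, _, _, hs, h => by rw [NonVal.subst, Exp.Scoped.subst_eq (hs.erase _) h]
  | .values es, _, _, hs, h => by rw [NonVal.subst, Exp.ScopedAll.subst_eq hs h]
  | .cons _ _, _, _, hs, ⟨h₁, h₂⟩ => by
      rw [NonVal.subst, Exp.Scoped.subst_eq hs h₁, Exp.Scoped.subst_eq hs h₂]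
  | .tuple es, _, _, hs, h => by rw [NonVal.subst, Exp.ScopedAll.subst_eq hs h]
  | .map kvs, _, _, hs, h => by rw [NonVal.subst, Exp.ScopedPairs.subst_eq hs h]
  | .call _ _ _, _, _, hs, ⟨h₁, h₂, h₃⟩ => by
      rw [NonVal.subst, Exp.Scoped.subst_eq hs h₁, Exp.Scoped.subst_eq hs h₂,
        Exp.ScopedAll.subst_eq hs h₃]
  | .primop _ es, _, _, hs, h => by rw [NonVal.subst, Exp.ScopedAll.subst_eq hs h]
  | .apply _ _, _, _, hs, ⟨h₁, h₂⟩ => by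
      rw [NonVal.subst, Exp.Scoped.subst_eq hs h₁, Exp.ScopedAll.subst_eq hs h₂]
  | .case _ _, _, _, hs, ⟨h₁, h₂⟩ => by
      rw [NonVal.subst, Exp.Scoped.subst_eq hs h₁, Clause.ScopedAll.subst_eq hs h₂]
  | .letIn _ _ _, _, _, hs, ⟨h₁, h₂⟩ => by
      rw [NonVal.subst, Exp.Scoped.subst_eq hs h₁, Exp.Scoped.subst_eq (hs.erase _) h₂]
  | .seq _ _, _, _, hs, ⟨h₁, h₂⟩ => by
      rw [NonVal.subst, Exp.Scoped.subst_eq hs h₁, Exp.Scoped.subst_eq hs h₂]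
  | .letrec ext e, _, _, hs, ⟨h₁, h₂⟩ => by
      rw [NonVal.subst, ClosItem.ScopedAll.subst_eq (hs.erase _) h₁,
        Exp.Scoped.subst_eq (hs.erase _) h₂]
  | .tryOf _ _ _ _ _, _, _, hs, ⟨h₁, h₂, h₃⟩ => by
      rw [NonVal.subst, Exp.Scoped.subst_eq hs h₁, Exp.Scoped.subst_eq (hs.erase _) h₂,
        Exp.Scoped.subst_eq (hs.erase _) h₃]

theorem Exp.Scoped.subst_eq : ∀ {e : Exp} {σ : Subst} {Γ : Set Name}, σ.Fixes Γ →
    e.Scoped Γ → e.subst σ = e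
  | .nonval n, _, _, hs, h => by rw [Exp.subst, NonVal.Scoped.subst_eq hs h]
  | .val v, _, _, hs, h => by rw [Exp.subst, Val.Scoped.subst_eq hs h]

theorem Exp.ScopedAll.subst_eq : ∀ {es : List Exp} {σ : Subst} {Γ : Set Name}, σ.Fixes Γ →
    Exp.ScopedAll es Γ → Exp.substAll es σ = es
  | [], _, _, _, _ => rfl
  | _ :: _, _, _, hs, ⟨h₁, h₂⟩ => by
      rw [Exp.substAll, Exp.Scoped.subst_eq hs h₁, Exp.ScopedAll.subst_eq hs h₂]

theorem Exp.ScopedPairs.subst_eq : ∀ {kvs : List (Exp × Exp)} {σ : Subst} {Γ : Set Name},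
    σ.Fixes Γ → Exp.ScopedPairs kvs Γ → Exp.substPairs kvs σ = kvs
  | [], _, _, _, _ => rfl
  | (_, _) :: _, _, _, hs, ⟨h₁, h₂, h₃⟩ => by
      rw [Exp.substPairs, Exp.Scoped.subst_eq hs h₁, Exp.Scoped.subst_eq hs h₂,
        Exp.ScopedPairs.subst_eq hs h₃]

end

theorem Val.Closed.subst_eq {v : Val} (h : v.Closed) (σ : Subst) : v.subst σ = v :=
  Val.Scoped.subst_eq (fun _ hy => hy.elim) h

/-- All values of the substitution are closed. -/
def Subst.ClosedRange (σ : Subst) : Prop := ∀ y v, σ y = some v → v.Closed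

theorem Subst.ClosedRange.erase {σ : Subst} (h : σ.ClosedRange) (s : Set Name) :
    (σ.erase s).ClosedRange := by
  intro y v hv
  by_cases hs : y ∈ s
  · simp [Subst.erase, hs] at hv
  · exact h y v (by simpa [Subst.erase, hs] using hv)

theorem Subst.erase_union (σ τ : Subst) (s : Set Name) :
    (σ.union τ).erase s = (σ.erase s).union (τ.erase s) := by
  funext y
  by_cases hs : y ∈ s <;> simp [Subst.erase, Subst.union, hs]

mutual

theorem Val.subst_subst : ∀ (v : Val) {σ : Subst} (_ : σ.ClosedRange) (τ : Subst),
    (v.subst σ).subst τ = v.subst (σ.union τ)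
  | .int _, _, _, _ => rfl
  | .atom _, _, _, _ => rfl
  | .var x, σ, hs, τ => by
      simp only [Val.subst, Subst.union]
      cases hx : σ (.var x) with
      | none => rfl
      | some v => exact (hs _ v hx).subst_eq τ
  | .fid f k, σ, hs, τ => by
      simp only [Val.subst, Subst.union]
      cases hx : σ (.fid f k) with
      | none => rfl
      | some v => exact (hs _ v hx).subst_eq τ
  | .clos ext xs e, σ, hs, τ => by
      simp only [Val.subst, namesOf_substAll, Subst.erase_union,
        ClosItem.substAll_substAll ext (hs.erase _), Exp.subst_subst e (hs.erase _)]
  | .cons v w, _, hs, τ => by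
      simp only [Val.subst, Val.subst_subst v hs, Val.subst_subst w hs]
  | .nil, _, _, _ => rfl
  | .tuple vs, _, hs, τ => by simp only [Val.subst, Val.substAll_substAll vs hs]
  | .map kvs, _, hs, τ => by simp only [Val.subst, Val.substPairs_substPairs kvs hs]

theorem Val.substAll_substAll : ∀ (vs : List Val) {σ : Subst} (_ : σ.ClosedRange) (τ : Subst),
    Val.substAll (Val.substAll vs σ) τ = Val.substAll vs (σ.union τ)
  | [], _, _, _ => rfl
  | v :: vs, _, hs, τ => by
      simp only [Val.substAll, Val.subst_subst v hs, Val.substAll_substAll vs hs]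

theorem Val.substPairs_substPairs : ∀ (kvs : List (Val × Val)) {σ : Subst}
    (_ : σ.ClosedRange) (τ : Subst),
    Val.substPairs (Val.substPairs kvs σ) τ = Val.substPairs kvs (σ.union τ)
  | [], _, _, _ => rfl
  | (k, v) :: kvs, _, hs, τ => by
      simp only [Val.substPairs, Val.subst_subst k hs, Val.subst_subst v hs,
        Val.substPairs_substPairs kvs hs]

theorem ClosItem.substAll_substAll : ∀ (ext : List ClosItem) {σ : Subst}
    (_ : σ.ClosedRange) (τ : Subst),
    ClosItem.substAll (ClosItem.substAll ext σ) τ = ClosItem.substAll ext (σ.union τ)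
  | [], _, _, _ => rfl
  | .mk _ _ e :: ext, _, hs, τ => by
      simp only [ClosItem.substAll, Subst.erase_union, Exp.subst_subst e (hs.erase _),
        ClosItem.substAll_substAll ext hs]

theorem Clause.substAll_substAll : ∀ (cls : List Clause) {σ : Subst}
    (_ : σ.ClosedRange) (τ : Subst),
    Clause.substAll (Clause.substAll cls σ) τ = Clause.substAll cls (σ.union τ)
  | [], _, _, _ => rfl
  | .mk _ g b :: cls, _, hs, τ => by
      simp only [Clause.substAll, Subst.erase_union, Exp.subst_subst g (hs.erase _),
        Exp.subst_subst b (hs.erase _), Clause.substAll_substAll cls hs]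

theorem NonVal.subst_subst : ∀ (n : NonVal) {σ : Subst} (_ : σ.ClosedRange) (τ : Subst),
    (n.subst σ).subst τ = n.subst (σ.union τ)
  | .lam _ e, _, hs, τ => by
      simp only [NonVal.subst, Subst.erase_union, Exp.subst_subst e (hs.erase _)]
  | .values es, _, hs, τ => by simp only [NonVal.subst, Exp.substAll_substAll es hs]
  | .cons e₁ e₂, _, hs, τ => by
      simp only [NonVal.subst, Exp.subst_subst e₁ hs, Exp.subst_subst e₂ hs]
  | .tuple es, _, hs, τ => by simp only [NonVal.subst, Exp.substAll_substAll es hs]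
  | .map kvs, _, hs, τ => by simp only [NonVal.subst, Exp.substPairs_substPairs kvs hs]
  | .call em ef es, _, hs, τ => by
      simp only [NonVal.subst, Exp.subst_subst em hs, Exp.subst_subst ef hs,
        Exp.substAll_substAll es hs]
  | .primop _ es, _, hs, τ => by simp only [NonVal.subst, Exp.substAll_substAll es hs]
  | .apply e es, _, hs, τ => by
      simp only [NonVal.subst, Exp.subst_subst e hs, Exp.substAll_substAll es hs]
  | .case e cls, _, hs, τ => by
      simp only [NonVal.subst, Exp.subst_subst e hs, Clause.substAll_substAll cls hs]
  | .letIn _ e₁ e₂, _, hs, τ => by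
      simp only [NonVal.subst, Subst.erase_union, Exp.subst_subst e₁ hs,
        Exp.subst_subst e₂ (hs.erase _)]
  | .seq e₁ e₂, _, hs, τ => by
      simp only [NonVal.subst, Exp.subst_subst e₁ hs, Exp.subst_subst e₂ hs]
  | .letrec ext e, _, hs, τ => by
      simp only [NonVal.subst, namesOf_substAll, Subst.erase_union,
        ClosItem.substAll_substAll ext (hs.erase _), Exp.subst_subst e (hs.erase _)]
  | .tryOf e₁ _ e₂ _ e₃, _, hs, τ => by
      simp only [NonVal.subst, Subst.erase_union, Exp.subst_subst e₁ hs,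
        Exp.subst_subst e₂ (hs.erase _), Exp.subst_subst e₃ (hs.erase _)]

theorem Exp.subst_subst : ∀ (e : Exp) {σ : Subst} (_ : σ.ClosedRange) (τ : Subst),
    (e.subst σ).subst τ = e.subst (σ.union τ)
  | .nonval n, _, hs, τ => by simp only [Exp.subst, NonVal.subst_subst n hs]
  | .val v, _, hs, τ => by simp only [Exp.subst, Val.subst_subst v hs]

theorem Exp.substAll_substAll : ∀ (es : List Exp) {σ : Subst} (_ : σ.ClosedRange) (τ : Subst),
    Exp.substAll (Exp.substAll es σ) τ = Exp.substAll es (σ.union τ)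
  | [], _, _, _ => rfl
  | e :: es, _, hs, τ => by
      simp only [Exp.substAll, Exp.subst_subst e hs, Exp.substAll_substAll es hs]

theorem Exp.substPairs_substPairs : ∀ (kvs : List (Exp × Exp)) {σ : Subst}
    (_ : σ.ClosedRange) (τ : Subst),
    Exp.substPairs (Exp.substPairs kvs σ) τ = Exp.substPairs kvs (σ.union τ)
  | [], _, _, _ => rfl
  | (k, v) :: kvs, _, hs, τ => by
      simp only [Exp.substPairs, Exp.subst_subst k hs, Exp.subst_subst v hs,
        Exp.substPairs_substPairs kvs hs]

end

/-! ## Termination -/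

theorem Step.det {K r K₁ r₁ K₂ r₂} (h₁ : Step K r K₁ r₁) (h₂ : Step K r K₂ r₂) :
    K₁ = K₂ ∧ r₁ = r₂ := by
  cases h₁ <;> cases h₂ <;> simp_all [Frame.IsTry]

theorem Step.not_result {r K' r'} (hr : r.IsResult) : ¬ Step [] r K' r' := by
  intro h
  cases h <;> exact hr

theorem TermIn.step {K r n K' r'} (h : TermIn K r n) (hs : Step K r K' r') :
    ∃ m, n = m + 1 ∧ TermIn K' r' m := by
  obtain ⟨res, hres, h⟩ := h
  cases h with
  | refl => exact (hs.not_result hres).elim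
  | head h t =>
    obtain ⟨rfl, rfl⟩ := h.det hs
    exact ⟨_, rfl, res, hres, t⟩

theorem TermIn.exists_step {F K r n} (h : TermIn (F :: K) r n) :
    ∃ m K' r', n = m + 1 ∧ Step (F :: K) r K' r' ∧ TermIn K' r' m := by
  obtain ⟨res, hres, h⟩ := h
  cases h with
  | head h t => exact ⟨_, _, _, rfl, h, res, hres, t⟩

theorem Term.of_step {K r K' r'} (h : Term K' r') (hs : Step K r K' r') : Term K r := by
  obtain ⟨n, res, hres, h⟩ := h
  exact ⟨n + 1, res, hres, .head hs h⟩

theorem Term.step {K r K' r'} (h : Term K r) (hs : Step K r K' r') : Term K' r' := by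
  obtain ⟨n, h⟩ := h
  obtain ⟨m, -, h⟩ := h.step hs
  exact ⟨m, h⟩

theorem Step.term_iff {K r K' r'} (hs : Step K r K' r') : Term K r ↔ Term K' r' :=
  ⟨fun h => h.step hs, fun h => h.of_step hs⟩

theorem Term.exists_step {F K r} (h : Term (F :: K) r) :
    ∃ K' r', Step (F :: K) r K' r' ∧ Term K' r' := by
  obtain ⟨n, h⟩ := h
  obtain ⟨m, K', r', -, hs, ht⟩ := h.exists_step
  exact ⟨K', r', hs, m, ht⟩

/-! ## Basic properties of the logical relations -/

theorem Val.scopedAll_iff {vs : List Val} {Γ : Set Name} :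
    Val.ScopedAll vs Γ ↔ ∀ v ∈ vs, v.Scoped Γ := by
  induction vs <;> simp_all [Val.ScopedAll]

theorem Exp.scopedAll_iff {es : List Exp} {Γ : Set Name} :
    Exp.ScopedAll es Γ ↔ ∀ e ∈ es, e.Scoped Γ := by
  induction es <;> simp_all [Exp.ScopedAll]

/-- Related entries of maps. -/
def PRel (n : ℕ) (p q : Val × Val) : Prop := VRel n p.1 q.1 ∧ VRel n p.2 q.2

theorem VRel.closed_left {n v w} (h : VRel n v w) : v.Closed := ((VRel_iff n v w).1 h).1

theorem VRel.closed_right {n v w} (h : VRel n v w) : w.Closed := ((VRel_iff n v w).1 h).2.1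

theorem VRel.scopedAll_left {n vs ws} (h : List.Forall₂ (VRel n) vs ws) :
    Val.ScopedAll vs ∅ := by
  induction h with
  | nil => trivial
  | cons h _ ih => exact ⟨h.closed_left, ih⟩

theorem VRel.scopedAll_right {n vs ws} (h : List.Forall₂ (VRel n) vs ws) :
    Val.ScopedAll ws ∅ := by
  induction h with
  | nil => trivial
  | cons h _ ih => exact ⟨h.closed_right, ih⟩

theorem VRel.int (n i) : VRel n (.int i) (.int i) := (VRel_iff ..).2 ⟨trivial, trivial, rfl⟩

theorem VRel.atom (n a) : VRel n (.atom a) (.atom a) := (VRel_iff ..).2 ⟨trivial, trivial, rfl⟩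

theorem VRel.nil (n) : VRel n .nil .nil := (VRel_iff ..).2 ⟨trivial, trivial, trivial⟩

theorem VRel.cons_iff {n v w v' w'} :
    VRel n (.cons v w) (.cons v' w') ↔ VRel n v v' ∧ VRel n w w' := by
  simp only [VRel_iff, Val.RelOf, Val.Closed, Val.Scoped]
  tauto

theorem VRel.tuple_iff {n vs ws} :
    VRel n (.tuple vs) (.tuple ws) ↔ List.Forall₂ (VRel n) vs ws := by
  rw [VRel_iff]
  simp only [Val.RelOf, Val.Closed, Val.Scoped]
  induction vs generalizing ws with
  | nil => cases ws <;> simp [Val.RelOfList, Val.ScopedAll]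
  | cons v vs ih =>
    cases ws with
    | nil => simp [Val.RelOfList]
    | cons w ws =>
      simp only [Val.RelOfList, Val.ScopedAll, List.forall₂_cons, ← ih, VRel_iff n v w, Val.Closed]
      tauto

theorem VRel.map_iff {n vs ws} :
    VRel n (.map vs) (.map ws) ↔ List.Forall₂ (PRel n) vs ws := by
  rw [VRel_iff]
  simp only [Val.RelOf, Val.Closed, Val.Scoped]
  induction vs generalizing ws with
  | nil => cases ws <;> simp [Val.RelOfPairs, Val.ScopedPairs]
  | cons v vs ih =>
    obtain ⟨k, v⟩ := v
    cases ws with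
    | nil => simp [Val.RelOfPairs]
    | cons w ws =>
      simp only [Val.RelOfPairs, Val.ScopedPairs, List.forall₂_cons, ← ih, PRel, VRel_iff n v,
        VRel_iff n k, Val.Closed]
      tauto

theorem VRel.clos_iff {n ext xs e ext' ys e'} :
    VRel n (.clos ext xs e) (.clos ext' ys e') ↔
      (Val.clos ext xs e).Closed ∧ (Val.clos ext' ys e').Closed ∧
        ClosRelOf VRel n ext xs e ext' ys e' := by
  rw [VRel_iff, Val.RelOf]

/-- Related values have the same shape. -/
inductive VShape (n : ℕ) : Val → Val → Prop
  | int (i) : VShape n (.int i) (.int i)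
  | atom (a) : VShape n (.atom a) (.atom a)
  | nil : VShape n .nil .nil
  | cons {v v' w w'} (h : VRel n v v') (h' : VRel n w w') : VShape n (.cons v w) (.cons v' w')
  | tuple {vs ws} (h : List.Forall₂ (VRel n) vs ws) : VShape n (.tuple vs) (.tuple ws)
  | map {vs ws} (h : List.Forall₂ (PRel n) vs ws) : VShape n (.map vs) (.map ws)
  | clos {ext xs e ext' ys e'} (h : VRel n (.clos ext xs e) (.clos ext' ys e'))
      (hl : xs.length = ys.length) : VShape n (.clos ext xs e) (.clos ext' ys e')

theorem VRel.shape {n v w} (h : VRel n v w) : VShape n v w := by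
  have h' := ((VRel_iff n v w).1 h).2.2
  cases v <;> cases w <;> simp only [Val.RelOf] at h'
  case int.int => exact h' ▸ .int _
  case atom.atom => exact h' ▸ .atom _
  case nil.nil => exact .nil
  case cons.cons => exact .cons (VRel.cons_iff.1 h).1 (VRel.cons_iff.1 h).2
  case tuple.tuple => exact .tuple (VRel.tuple_iff.1 h)
  case map.map => exact .map (VRel.map_iff.1 h)
  case clos.clos => exact .clos h h'.1

mutual

theorem VRel.mono : ∀ {v w : Val} {m n : ℕ}, m ≤ n → VRel n v w → VRel m v w
  | .int _, _, _, _, _, h => by cases h.shape; exact VRel.int _ _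
  | .atom _, _, _, _, _, h => by cases h.shape; exact VRel.atom _ _
  | .var _, _, _, _, _, h => by cases h.shape
  | .fid _ _, _, _, _, _, h => by cases h.shape
  | .clos _ _ _, _, _, _, hm, h => by
      cases h.shape with
      | clos h =>
        rw [VRel.clos_iff] at h ⊢
        exact ⟨h.1, h.2.1, h.2.2.1, fun k hk => h.2.2.2 k (hk.trans_le hm)⟩
  | .cons _ _, _, _, _, hm, h => by
      cases h.shape with
      | cons h₁ h₂ => exact VRel.cons_iff.2 ⟨VRel.mono hm h₁, VRel.mono hm h₂⟩
  | .nil, _, _, _, _, h => by cases h.shape; exact VRel.nil _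
  | .tuple vs, _, _, _, hm, h => by
      cases h.shape with
      | tuple h' => exact VRel.tuple_iff.2 (VRel.mono_list hm h')
  | .map kvs, _, _, _, hm, h => by
      cases h.shape with
      | map h' => exact VRel.map_iff.2 (VRel.mono_pairs hm h')

theorem VRel.mono_list : ∀ {vs ws : List Val} {m n : ℕ}, m ≤ n →
    List.Forall₂ (VRel n) vs ws → List.Forall₂ (VRel m) vs ws
  | [], _, _, _, _, h => by cases h; exact .nil
  | _ :: _, _, _, _, hm, h => by
      cases h with
      | cons h₁ h₂ => exact .cons (VRel.mono hm h₁) (VRel.mono_list hm h₂)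

theorem VRel.mono_pairs : ∀ {vs ws : List (Val × Val)} {m n : ℕ}, m ≤ n →
    List.Forall₂ (PRel n) vs ws → List.Forall₂ (PRel m) vs ws
  | [], _, _, _, _, h => by cases h; exact .nil
  | (_, _) :: _, _, _, _, hm, h => by
      cases h with
      | cons h₁ h₂ => exact .cons ⟨VRel.mono hm h₁.1, VRel.mono hm h₁.2⟩ (VRel.mono_pairs hm h₂)

end

theorem XRel.mono {x y m n} (hm : m ≤ n) (h : XRel n x y) : XRel m x y :=
  ⟨h.1, h.2.1.mono hm, h.2.2.mono hm⟩

theorem KRel.mono {K₁ K₂ m n} (hm : m ≤ n) (h : KRel n K₁ K₂) : KRel m K₁ K₂ :=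
  ⟨h.1, h.2.1, fun k hk => h.2.2.1 k (hk.trans hm), fun k hk => h.2.2.2.1 k (hk.trans hm),
    fun k hk => h.2.2.2.2 k (hk.trans hm)⟩

theorem ERel.mono {e₁ e₂ m n} (hm : m ≤ n) (h : ERel n e₁ e₂) : ERel m e₁ e₂ :=
  ⟨h.1, h.2.1, fun k hk => h.2.2 k (hk.trans hm)⟩

/-- The second configuration terminates if the first one does so in at most `n` steps. -/
def Sim (n : ℕ) (K₁ : FrameStack) (r₁ : Redex) (K₂ : FrameStack) (r₂ : Redex) : Prop :=
  ∀ m ≤ n, TermIn K₁ r₁ m → Term K₂ r₂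

/-- Related redexes. -/
inductive RRel (n : ℕ) : Redex → Redex → Prop
  | vals {vs ws} (h : List.Forall₂ (VRel n) vs ws) : RRel n (.vals vs) (.vals ws)
  | exc {x y} (h : XRel n x y) : RRel n (.exc x) (.exc y)
  | exp {e₁ e₂} (h : ERel n e₁ e₂) : RRel n (.exp e₁) (.exp e₂)
  | box : RRel n .box .box

theorem RRel.sim {n r₁ r₂ K₁ K₂} (h : RRel n r₁ r₂) (hK : KRel n K₁ K₂) :
    Sim n K₁ r₁ K₂ r₂ := by
  intro m hm ht
  cases h with
  | vals h => exact hK.2.2.1 m hm _ _ (VRel.mono_list hm h) ht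
  | exc h => exact hK.2.2.2.1 m hm _ _ (h.mono hm) ht
  | exp h => exact h.2.2 m hm K₁ K₂ (hK.mono hm) ht
  | box => exact hK.2.2.2.2 m hm ht

theorem ERel.sim {n e₁ e₂ K₁ K₂} (h : ERel n e₁ e₂) (hK : KRel n K₁ K₂) :
    Sim n K₁ (.exp e₁) K₂ (.exp e₂) := (RRel.exp h).sim hK

/-! ## The order of terms on related values -/

mutual

theorem VRel.cmp_eq : ∀ {v v' w w' : Val} {n : ℕ}, VRel n v v' → VRel n w w' →
    v.cmp w = v'.cmp w'
  | .int _, _, _, _, _, h, h' => by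
      rcases h.shape; rcases h'.shape <;> simp [Val.cmp, Val.rank]
  | .atom _, _, _, _, _, h, h' => by
      rcases h.shape; rcases h'.shape <;> simp [Val.cmp, Val.rank]
  | .var _, _, _, _, _, h, _ => by cases h.shape
  | .fid _ _, _, _, _, _, h, _ => by cases h.shape
  | .clos _ _ _, _, _, _, _, h, h' => by
      rcases h.shape; rcases h'.shape <;> simp_all [Val.cmp, Val.rank]
  | .cons _ _, _, _, _, _, h, h' => by
      obtain _ | _ | _ | ⟨h₁, h₂⟩ := h.shape
      obtain _ | _ | _ | ⟨h₁', h₂'⟩ | _ | _ | _ := h'.shape <;> simp only [Val.cmp, Val.rank]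
      rw [VRel.cmp_eq h₁ h₁', VRel.cmp_eq h₂ h₂']
  | .nil, _, _, _, _, h, h' => by
      rcases h.shape; rcases h'.shape <;> simp [Val.cmp, Val.rank]
  | .tuple vs, _, _, _, _, h, h' => by
      obtain _ | _ | _ | _ | h₁ := h.shape
      obtain _ | _ | _ | _ | h₂ | _ | _ := h'.shape <;> simp only [Val.cmp, Val.rank]
      rw [VRel.cmpList_eq h₁ h₂, h₁.length_eq, h₂.length_eq]
  | .map kvs, _, _, _, _, h, h' => by
      obtain _ | _ | _ | _ | _ | h₁ := h.shape
      obtain _ | _ | _ | _ | _ | h₂ | _ := h'.shape <;> simp only [Val.cmp, Val.rank]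
      rw [VRel.cmpPairs_eq h₁ h₂, h₁.length_eq, h₂.length_eq]

theorem VRel.cmpList_eq : ∀ {v v' w w' : List Val} {n : ℕ}, List.Forall₂ (VRel n) v v' →
    List.Forall₂ (VRel n) w w' → Val.cmpList v w = Val.cmpList v' w'
  | [], _, _, _, _, h, h' => by cases h; simp [Val.cmpList]
  | _ :: _, _, _, _, _, .cons h₁ h₂, h' => by
      obtain _ | ⟨h₁', h₂'⟩ := h'
      · simp [Val.cmpList]
      · rw [Val.cmpList, Val.cmpList, VRel.cmp_eq h₁ h₁', VRel.cmpList_eq h₂ h₂']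

theorem VRel.cmpPairs_eq : ∀ {v v' w w' : List (Val × Val)} {n : ℕ},
    List.Forall₂ (PRel n) v v' → List.Forall₂ (PRel n) w w' →
    Val.cmpPairs v w = Val.cmpPairs v' w'
  | [], _, _, _, _, h, h' => by cases h; simp [Val.cmpPairs]
  | (_, _) :: _, _, _, _, _, .cons h₁ h₂, h' => by
      obtain _ | ⟨h₁', h₂'⟩ := h'
      · simp [Val.cmpPairs]
      · rw [Val.cmpPairs, Val.cmpPairs, VRel.cmp_eq h₁.1 h₁'.1, VRel.cmp_eq h₁.2 h₁'.2,
          VRel.cmpPairs_eq h₂ h₂']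

end

theorem mapInsert_rel {n k k' v v'} (hk : VRel n k k') (hv : VRel n v v') {l l'}
    (h : List.Forall₂ (PRel n) l l') :
    List.Forall₂ (PRel n) (mapInsert k v l) (mapInsert k' v' l') := by
  induction h with
  | nil => exact .cons ⟨hk, hv⟩ .nil
  | @cons p q l l' h t ih =>
    obtain ⟨p₁, p₂⟩ := p
    obtain ⟨q₁, q₂⟩ := q
    simp only [mapInsert, ← hk.cmp_eq h.1]
    split
    · exact .cons ⟨hk, hv⟩ (.cons h t)
    · exact .cons h t
    · exact .cons h ih

theorem makeMap_rel {n l l'} (h : List.Forall₂ (PRel n) l l') :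
    List.Forall₂ (PRel n) (makeMap l) (makeMap l') := by
  induction h with
  | nil => exact .nil
  | cons h _ ih => exact mapInsert_rel h.1 h.2 ih

theorem pairUp_rel {n} : ∀ {l l'}, List.Forall₂ (VRel n) l l' →
    Option.Rel (List.Forall₂ (PRel n)) (pairUp l) (pairUp l')
  | [], _, .nil => .some .nil
  | [_], _, .cons _ .nil => .none
  | _ :: _ :: l, _, .cons h (.cons (l₂ := l') h' t) => by
      have ih := pairUp_rel t
      simp only [pairUp]
      cases ha : pairUp l <;> cases hb : pairUp l' <;> rw [ha, hb] at ih <;> cases ih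
      · exact .none
      · next ih => exact .some (.cons ⟨h, h'⟩ ih)

/-! ## Built-in functions on related values -/

theorem VRel.rank_eq {n v w} (h : VRel n v w) : v.rank = w.rank := by
  cases h.shape <;> rfl

theorem VRel.toBool_eq {n v w} (h : VRel n v w) : v.toBool = w.toBool := by
  cases h.shape <;> rfl

theorem VRel.ofBool (n b) : VRel n (.ofBool b) (.ofBool b) := VRel.atom _ _

theorem RRel.one {n v w} (h : VRel n v w) : RRel n (.one v) (.one w) := .vals (.cons h .nil)

theorem RRel.error {n v w} (a : Atom) (h : VRel n v w) : RRel n (.error a v) (.error a w) :=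
  .exc ⟨rfl, VRel.atom _ _, h⟩

theorem VRel.toList_rel {n} : ∀ {v w}, VRel n v w →
    Option.Rel (List.Forall₂ (VRel n)) v.toList w.toList
  | .cons v v', _, h => by
      obtain _ | _ | _ | @⟨_, w, _, w', h₁, h₂⟩ := h.shape
      have ih := VRel.toList_rel h₂
      simp only [Val.toList]
      cases ha : v'.toList <;> cases hb : w'.toList <;> rw [ha, hb] at ih <;> cases ih
      · exact .none
      · next ih => exact .some (.cons h₁ ih)
  | .nil, _, h => by cases h.shape; exact .some .nil
  | .int _, _, h => by cases h.shape; exact .none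
  | .atom _, _, h => by cases h.shape; exact .none
  | .var _, _, h => by cases h.shape
  | .fid _ _, _, h => by cases h.shape
  | .clos _ _ _, _, h => by cases h.shape; exact .none
  | .tuple _, _, h => by cases h.shape; exact .none
  | .map _, _, h => by cases h.shape; exact .none

theorem VRel.ofList_rel {n v w l l'} (h : VRel n v w) (hl : List.Forall₂ (VRel n) l l') :
    VRel n (.ofList l v) (.ofList l' w) := by
  induction hl with
  | nil => exact h
  | cons h _ ih => exact VRel.cons_iff.2 ⟨h, ih⟩

theorem removeFirst_rel {n v w l l'} (h : VRel n v w) (hl : List.Forall₂ (VRel n) l l') :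
    List.Forall₂ (VRel n) (removeFirst v l) (removeFirst w l') := by
  induction hl with
  | nil => exact .nil
  | cons h' t ih =>
    simp only [removeFirst, h.cmp_eq h']
    split
    · exact t
    · exact .cons h' ih

theorem foldl_removeFirst_rel {n l l' k k'} (hk : List.Forall₂ (VRel n) k k')
    (hl : List.Forall₂ (VRel n) l l') :
    List.Forall₂ (VRel n) (k.foldl (fun acc x => removeFirst x acc) l)
      (k'.foldl (fun acc x => removeFirst x acc) l') := by
  induction hk generalizing l l' with
  | nil => exact hl
  | cons h _ ih => exact ih (removeFirst_rel h hl)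

theorem forall₂_set {α β : Type*} {R : α → β → Prop} {l l' v w} (hl : List.Forall₂ R l l')
    (h : R v w) (i : ℕ) : List.Forall₂ R (l.set i v) (l'.set i w) := by
  induction hl generalizing i with
  | nil => exact .nil
  | cons h' t ih =>
    cases i with
    | zero => exact .cons h t
    | succ i => exact .cons h' (ih i)

theorem forall₂_getElem? {α β : Type*} {R : α → β → Prop} {l l'} (hl : List.Forall₂ R l l')
    (i : ℕ) : Option.Rel R l[i]? l'[i]? := by
  induction hl generalizing i with
  | nil => exact .none
  | cons h t ih =>
    cases i with
    | zero => exact .some h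
    | succ i => simpa using ih i

theorem _root_.Option.Rel.map_rel {α β γ δ : Type*} {R : α → β → Prop} {S : γ → δ → Prop}
    {a b} {f : α → γ} {g : β → δ} (h : Option.Rel R a b) (hfg : ∀ x y, R x y → S (f x) (g y)) :
    Option.Rel S (a.map f) (b.map g) := by
  cases h with
  | none => exact .none
  | some h => exact .some (hfg _ _ h)

theorem _root_.Option.Rel.bind_rel {α β γ δ : Type*} {R : α → β → Prop} {S : γ → δ → Prop}
    {a b} {f : α → Option γ} {g : β → Option δ} (h : Option.Rel R a b)
    (hfg : ∀ x y, R x y → Option.Rel S (f x) (g y)) :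
    Option.Rel S (a.bind f) (b.bind g) := by
  cases h with
  | none => exact .none
  | some h => exact hfg _ _ h

theorem ite_none_rel {α β : Type*} {R : α → β → Prop} {c : Prop} [Decidable c] {a b}
    (h : c → Option.Rel R a b) :
    Option.Rel R (if c then a else none) (if c then b else none) := by
  split
  · exact h ‹_›
  · exact .none

theorem Bif.run_rel {n : ℕ} (b : Bif) {vs ws : List Val} (h : List.Forall₂ (VRel n) vs ws) :
    Option.Rel (RRel n) (b.run vs) (b.run ws) := by
  obtain _ | ⟨h₁, _ | ⟨h₂, _ | ⟨h₃, _ | ⟨h₄, h₅⟩⟩⟩⟩ := h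
  · cases b <;> exact .none
  · cases b
    case add | sub | abs =>
      cases h₁.shape
      case int => exact .some (.one (VRel.int _ _))
      all_goals exact .none
    case hd | tl =>
      cases h₁.shape
      case cons h h' => first | exact .some (.one h) | exact .some (.one h')
      all_goals exact .none
    case tupleSize | mapSize =>
      cases h₁.shape
      case tuple h => first | exact .none | exact .some (.one (h.length_eq ▸ VRel.int _ _))
      case map h => first | exact .none | exact .some (.one (h.length_eq ▸ VRel.int _ _))
      all_goals exact .none
    case tupleToList =>
      cases h₁.shape
      case tuple h => exact .some (.one ((VRel.nil n).ofList_rel h))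
      all_goals exact .none
    case not =>
      simp only [Bif.run, h₁.toBool_eq]
      cases Val.toBool _
      · exact .none
      · exact .some (.one (VRel.ofBool _ _))
    case isInteger | isNumber | isAtom | isBoolean | isList | isTuple | isMap | isFunction =>
      simp only [Bif.run, h₁.toBool_eq, h₁.rank_eq]
      exact .some (.one (VRel.ofBool _ _))
    case length =>
      exact h₁.toList_rel.map_rel fun l l' hl => .one (hl.length_eq ▸ VRel.int _ _)
    case listToTuple =>
      exact h₁.toList_rel.map_rel fun l l' hl => .one (VRel.tuple_iff.2 hl)
    case error | exit | throw => exact .some (.exc ⟨rfl, h₁, VRel.nil n⟩)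
    all_goals first | exact .none | (cases h₁.shape <;> exact .none)
  · cases b
    case add | sub | mul | bsl | bsr =>
      cases h₁.shape
      case int =>
        cases h₂.shape
        case int => exact .some (.one (VRel.int _ _))
        all_goals exact .none
      all_goals exact .none
    case div | rem =>
      cases h₁.shape
      case int =>
        cases h₂.shape
        case int =>
          simp only [Bif.run]
          split
          · exact .none
          · exact .some (.one (VRel.int _ _))
        all_goals exact .none
      all_goals exact .none
    case and | or =>
      simp only [Bif.run, h₁.toBool_eq, h₂.toBool_eq]
      cases Val.toBool _
      · exact .none
      · cases Val.toBool _
        · exact .none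
        · exact .some (.one (VRel.ofBool _ _))
    case eq | ne | exactEq | exactNe | lt | le | gt | ge =>
      simp only [Bif.run, h₁.cmp_eq h₂]
      exact .some (.one (VRel.ofBool _ _))
    case append =>
      exact h₁.toList_rel.map_rel fun l l' hl => .one (h₂.ofList_rel hl)
    case subtract =>
      exact h₁.toList_rel.bind_rel fun l l' hl => h₂.toList_rel.map_rel fun k k' hk =>
        .one ((VRel.nil n).ofList_rel (foldl_removeFirst_rel hk hl))
    case element =>
      cases h₁.shape
      case int =>
        cases h₂.shape
        case tuple h =>
          simp only [Bif.run]
          split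
          · exact (forall₂_getElem? h _).map_rel fun v w hv => .one hv
          · exact .none
        all_goals exact .none
      all_goals exact .none
    case isFunction =>
      cases h₂.shape
      case int =>
        cases h₁.shape
        case clos hl =>
          exact ite_none_rel fun _ => .some (.one (by rw [hl]; exact VRel.ofBool _ _))
        all_goals exact ite_none_rel fun _ => .some (.one (VRel.ofBool _ _))
      all_goals cases h₁.shape <;> exact .none
    case funInfo =>
      cases h₁.shape
      case clos hl =>
        cases h₂.shape
        case atom =>
          simp only [Bif.run]
          split
          · exact .some (.one (VRel.tuple_iff.2
              (.cons (VRel.atom _ _) (.cons (hl ▸ VRel.int _ _) .nil))))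
          · exact .none
        all_goals exact .none
      all_goals exact .none
    case error => exact .some (.exc ⟨rfl, h₁, h₂⟩)
    all_goals first
      | exact .none
      | (cases h₁.shape <;> first | exact .none | (cases h₂.shape <;> exact .none))
  · cases b
    case setElement =>
      cases h₁.shape
      case int =>
        cases h₂.shape
        case tuple h =>
          simp only [Bif.run, h.length_eq]
          split
          · exact .some (.one (VRel.tuple_iff.2 (forall₂_set h h₃ _)))
          · exact .none
        all_goals exact .none
      all_goals exact .none
    all_goals first
      | exact .none
      | (cases h₁.shape <;> first | exact .none | (cases h₂.shape <;> exact .none))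
  · cases b
    all_goals first
      | exact .none
      | (cases h₁.shape <;> first | exact .none | (cases h₂.shape <;> exact .none))

theorem evalCall_rel {n vs ws} (m f : Atom) (h : List.Forall₂ (VRel n) vs ws) :
    RRel n (evalCall m f vs) (evalCall m f ws) := by
  have hu : RRel n (.error atUndef (.tuple [.atom m, .atom f, .int vs.length]))
      (.error atUndef (.tuple [.atom m, .atom f, .int ws.length])) :=
    .error _ (VRel.tuple_iff.2 (.cons (VRel.atom _ _) (.cons (VRel.atom _ _)
      (.cons (h.length_eq ▸ VRel.int _ _) .nil))))
  simp only [evalCall]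
  split
  · exact hu
  · next b _ =>
    rw [h.length_eq] at hu ⊢
    split
    · have hr := b.run_rel h
      cases ha : b.run vs <;> cases hb : b.run ws <;> rw [ha, hb] at hr <;> cases hr
      · exact .error _ (VRel.tuple_iff.2 (.cons (VRel.atom _ _) h))
      · assumption
    · exact hu

theorem evalPrimop_rel {n vs ws} (a : Atom) (h : List.Forall₂ (VRel n) vs ws) :
    RRel n (evalPrimop a vs) (evalPrimop a ws) := by
  have hu : RRel n (.error atUndef (.tuple [.atom a, .int vs.length]))
      (.error atUndef (.tuple [.atom a, .int ws.length])) :=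
    .error _ (VRel.tuple_iff.2 (.cons (VRel.atom _ _)
      (.cons (h.length_eq ▸ VRel.int _ _) .nil)))
  simp only [evalPrimop]
  split
  · obtain _ | ⟨h₁, _ | ⟨h₂, h₃⟩⟩ := h
    · exact hu
    · exact .exc ⟨rfl, h₁, VRel.nil n⟩
    · exact hu
  · exact hu

/-- Related frame identifiers. -/
inductive IdRel (n : ℕ) : FrameId → FrameId → Prop
  | tuple : IdRel n .tuple .tuple
  | values : IdRel n .values .values
  | call {v w v' w'} (h : VRel n v v') (h' : VRel n w w') : IdRel n (.call v w) (.call v' w')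
  | primop (a) : IdRel n (.primop a) (.primop a)
  | map : IdRel n .map .map
  | app {v w} (h : VRel n v w) : IdRel n (.app v) (.app w)

theorem IdRel.closed_left {n i j} (h : IdRel n i j) : i.Closed := by
  cases h with
  | call h h' => exact ⟨h.closed_left, h'.closed_left⟩
  | app h => exact h.closed_left
  | _ => trivial

theorem IdRel.closed_right {n i j} (h : IdRel n i j) : j.Closed := by
  cases h with
  | call h h' => exact ⟨h.closed_right, h'.closed_right⟩
  | app h => exact h.closed_right
  | _ => trivial

theorem IdRel.mono {m n i j} (hm : m ≤ n) (h : IdRel n i j) : IdRel m i j := by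
  cases h <;> constructor <;> exact VRel.mono hm ‹_›

theorem IdRel.map_iff {n i j} (h : IdRel n i j) : i = .map ↔ j = .map := by
  cases h <;> simp

theorem eval_rel {m n i j vs ws} (hm : m < n) (hi : IdRel n i j)
    (h : List.Forall₂ (VRel n) vs ws) : Option.Rel (RRel m) (eval i vs) (eval j ws) := by
  have h' := VRel.mono_list hm.le h
  cases hi with
  | tuple => exact .some (.one (VRel.tuple_iff.2 h'))
  | values => exact .some (.vals h')
  | primop a => exact .some (evalPrimop_rel a h')
  | map => exact (pairUp_rel h').map_rel fun l l' hl => .one (VRel.map_iff.2 (makeMap_rel hl))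
  | app hv =>
    cases hv.shape
    case clos xs _ _ ys _ _ hl =>
      simp only [eval]
      by_cases hc : vs.length = xs.length
      · rw [if_pos hc, if_pos (by rw [← h.length_eq, hc, hl])]
        exact .some (.exp ((VRel.clos_iff.1 hv).2.2.2 m hm vs ws hc h'))
      · rw [if_neg hc, if_neg (by rwa [← h.length_eq, ← hl])]
        exact .some (.error _ (hv.mono hm.le))
    all_goals exact .some (.error _ (hv.mono hm.le))
  | call hv hw =>
    have hv' := hv.mono hm.le
    have hw' := hw.mono hm.le
    have he := VRel.tuple_iff.2 (List.Forall₂.cons hv' (.cons hw' .nil))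
    cases hv.shape
    case atom =>
      cases hw.shape
      case atom => exact .some (evalCall_rel _ _ h')
      all_goals exact .some (.error _ he)
    all_goals exact .some (.error _ he)

/-! ## Compatibility of frames -/

theorem FrameStack.Closed.cons {F : Frame} {K : FrameStack} (hF : F.Closed) (hK : K.Closed) :
    FrameStack.Closed (F :: K) := by
  intro G hG
  rcases List.mem_cons.1 hG with rfl | hG
  · exact hF
  · exact hK G hG

/-- Every step of the first configuration is matched by a step of the second one. -/
def StepSim (m : ℕ) (K₁ : FrameStack) (r₁ : Redex) (K₂ : FrameStack) (r₂ : Redex) : Prop :=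
  ∀ K₁' r₁', Step K₁ r₁ K₁' r₁' → ∃ K₂' r₂', Step K₂ r₂ K₂' r₂' ∧ Sim m K₁' r₁' K₂' r₂'

theorem StepSim.term {m F K₁ r₁ K₂ r₂} (h : StepSim m (F :: K₁) r₁ K₂ r₂)
    (ht : TermIn (F :: K₁) r₁ (m + 1)) : Term K₂ r₂ := by
  obtain ⟨k, K', r', hk, hs, ht⟩ := ht.exists_step
  obtain ⟨K₂', r₂', hs₂, hsim⟩ := h _ _ hs
  obtain rfl : m = k := by omega
  exact (hsim m le_rfl ht).of_step hs₂

theorem KRel.push {n F₁ F₂ K₁ K₂} (hK : KRel n K₁ K₂) (c₁ : F₁.Closed) (c₂ : F₂.Closed)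
    (hv : ∀ m < n, ∀ vs ws, List.Forall₂ (VRel (m + 1)) vs ws →
      StepSim m (F₁ :: K₁) (.vals vs) (F₂ :: K₂) (.vals ws))
    (hx : ∀ m < n, ∀ x y, XRel (m + 1) x y →
      StepSim m (F₁ :: K₁) (.exc x) (F₂ :: K₂) (.exc y))
    (hb : ∀ m < n, StepSim m (F₁ :: K₁) .box (F₂ :: K₂) .box) :
    KRel n (F₁ :: K₁) (F₂ :: K₂) := by
  refine ⟨.cons c₁ hK.1, .cons c₂ hK.2.1, fun m hm vs ws h ht => ?_, fun m hm x y h ht => ?_,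
    fun m hm ht => ?_⟩ <;> obtain ⟨m, -, -, rfl, -, -⟩ := ht.exists_step
  · exact (hv m hm vs ws h).term ht
  · exact (hx m hm x y h).term ht
  · exact (hb m hm).term ht

theorem KRel.push_of_not_try {n F₁ F₂ K₁ K₂} (hK : KRel n K₁ K₂) (c₁ : F₁.Closed)
    (c₂ : F₂.Closed) (t₁ : ¬ F₁.IsTry) (t₂ : ¬ F₂.IsTry)
    (hv : ∀ m < n, ∀ vs ws, List.Forall₂ (VRel (m + 1)) vs ws →
      StepSim m (F₁ :: K₁) (.vals vs) (F₂ :: K₂) (.vals ws))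
    (hb : ∀ m < n, StepSim m (F₁ :: K₁) .box (F₂ :: K₂) .box) :
    KRel n (F₁ :: K₁) (F₂ :: K₂) := by
  refine hK.push c₁ c₂ hv (fun m hm x y h K' r' hs => ?_) hb
  cases hs with
  | excTry => exact (t₁ trivial).elim
  | excProp =>
    exact ⟨K₂, .exc y, .excProp K₂ F₂ y t₂, (RRel.exc (h.mono m.le_succ)).sim (hK.mono hm.le)⟩

theorem KRel.seq {n e₁ e₂ K₁ K₂} (hK : KRel n K₁ K₂) (he : ERel n e₁ e₂) :
    KRel n (.seq e₁ :: K₁) (.seq e₂ :: K₂) := by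
  refine hK.push_of_not_try he.1 he.2.1 id id (fun m hm vs ws h K' r' hs => ?_) ?_
  · cases hs
    obtain _ | ⟨h, _ | _⟩ := h
    exact ⟨_, _, .pSeq .., (he.mono hm.le).sim (hK.mono hm.le)⟩
  · intro m hm K' r' hs
    cases hs

theorem KRel.consHead {n v₁ v₂ K₁ K₂} (hK : KRel n K₁ K₂) (hv : VRel n v₁ v₂) :
    KRel n (.consHead v₁ :: K₁) (.consHead v₂ :: K₂) := by
  refine hK.push_of_not_try hv.closed_left hv.closed_right id id
    (fun m hm vs ws h K' r' hs => ?_) ?_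
  · cases hs
    obtain _ | ⟨h, _ | _⟩ := h
    exact ⟨_, _, .pCons .., (RRel.one (VRel.cons_iff.2
      ⟨h.mono m.le_succ, hv.mono hm.le⟩)).sim (hK.mono hm.le)⟩
  · intro m hm K' r' hs
    cases hs

theorem KRel.consTail {n e₁ e₂ K₁ K₂} (hK : KRel n K₁ K₂) (he : ERel n e₁ e₂) :
    KRel n (.consTail e₁ :: K₁) (.consTail e₂ :: K₂) := by
  refine hK.push_of_not_try he.1 he.2.1 id id (fun m hm vs ws h K' r' hs => ?_) ?_
  · cases hs
    obtain _ | ⟨h, _ | _⟩ := h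
    exact ⟨_, _, .sConsHead .., (he.mono hm.le).sim
      ((hK.mono hm.le).consHead (h.mono m.le_succ))⟩
  · intro m hm K' r' hs
    cases hs

theorem ERel.scopedAll {n es es'} (h : List.Forall₂ (ERel n) es es') :
    Exp.ScopedAll es ∅ ∧ Exp.ScopedAll es' ∅ := by
  induction h with
  | nil => exact ⟨trivial, trivial⟩
  | cons h _ ih => exact ⟨⟨h.1, ih.1⟩, h.2.1, ih.2⟩

theorem ERel.mono_list {m n es es'} (hm : m ≤ n) (h : List.Forall₂ (ERel n) es es') :
    List.Forall₂ (ERel m) es es' := h.imp fun _ _ h => h.mono hm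

theorem KRel.params {n i j vs ws es es' K₁ K₂} (hK : KRel n K₁ K₂) (hi : IdRel n i j)
    (hv : List.Forall₂ (VRel n) vs ws) (he : List.Forall₂ (ERel n) es es')
    (hp : i = .map → Even (vs.length + 1 + es.length)) :
    KRel n (.params i vs es :: K₁) (.params j ws es' :: K₂) := by
  induction es generalizing n vs ws es' K₁ K₂ with
  | nil =>
    cases he
    refine hK.push_of_not_try
      ⟨hi.closed_left, VRel.scopedAll_left hv, trivial, hp⟩
      ⟨hi.closed_right, VRel.scopedAll_right hv, trivial,
        fun h => by simpa [hv.length_eq] using hp (hi.map_iff.2 h)⟩ id id ?_ ?_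
    · intro m hm us us' hu K' r' hs
      cases hs with
      | pParams _ _ _ v r hr =>
        obtain _ | ⟨hu, _ | _⟩ := hu
        have ha := List.rel_append (VRel.mono_list hm hv) (.cons hu .nil)
        have := eval_rel m.lt_succ_self (hi.mono hm) ha
        rw [hr] at this
        generalize hr' : eval j _ = o at this
        cases this with
        | some h => exact ⟨_, _, .pParams _ _ _ _ _ hr', h.sim (hK.mono hm.le)⟩
    · intro m hm K' r' hs
      cases hs with
      | pParams₀ _ _ _ r h hr =>
        have := eval_rel hm hi hv
        rw [hr] at this
        generalize hr' : eval j _ = o at this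
        cases this with
        | some h' =>
          exact ⟨_, _, .pParams₀ _ _ _ _ (mt hi.map_iff.2 h) hr', h'.sim (hK.mono hm.le)⟩
  | cons e es ih =>
    obtain _ | ⟨h, t⟩ := he
    refine hK.push_of_not_try
      ⟨hi.closed_left, VRel.scopedAll_left hv, (ERel.scopedAll (.cons h t)).1, hp⟩
      ⟨hi.closed_right, VRel.scopedAll_right hv, (ERel.scopedAll (.cons h t)).2,
        fun h => by simpa [hv.length_eq, t.length_eq] using hp (hi.map_iff.2 h)⟩ id id ?_ ?_
    · intro m hm us us' hu K' r' hs
      cases hs with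
      | sParams _ _ _ v =>
        obtain _ | ⟨hu, _ | _⟩ := hu
        refine ⟨_, _, .sParams .., (h.mono hm.le).sim
          (ih (hK.mono hm.le) (hi.mono hm.le) (List.rel_append (VRel.mono_list hm.le hv)
            (.cons (hu.mono m.le_succ) .nil)) (ERel.mono_list hm.le t) fun hmap => ?_)⟩
        have := hp hmap
        simp only [List.length_append, List.length_cons, List.length_nil] at this ⊢
        convert this using 1
        omega
    · intro m hm K' r' hs
      cases hs with
      | sParams₀ _ _ _ _ hne =>
        cases hv
        exact ⟨_, _, .sParams₀ _ _ _ _ (mt hi.map_iff.2 hne), (h.mono hm.le).sim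
          (ih (hK.mono hm.le) (hi.mono hm.le) .nil (ERel.mono_list hm.le t)
            fun h => (hne h).elim)⟩

theorem KRel.callFun {n v₁ v₂ es es' K₁ K₂} (hK : KRel n K₁ K₂) (hv : VRel n v₁ v₂)
    (he : List.Forall₂ (ERel n) es es') :
    KRel n (.callFun v₁ es :: K₁) (.callFun v₂ es' :: K₂) := by
  refine hK.push_of_not_try ⟨hv.closed_left, (ERel.scopedAll he).1⟩
    ⟨hv.closed_right, (ERel.scopedAll he).2⟩ id id (fun m hm vs ws h K' r' hs => ?_) ?_
  · cases hs
    obtain _ | ⟨h, _ | _⟩ := h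
    exact ⟨_, _, .sCallParam .., RRel.box.sim ((hK.mono hm.le).params
      (.call (hv.mono hm.le) (h.mono m.le_succ)) .nil (ERel.mono_list hm.le he) nofun)⟩
  · intro m hm K' r' hs
    cases hs

theorem KRel.callMod {n e₁ e₂ es es' K₁ K₂} (hK : KRel n K₁ K₂) (h₁ : ERel n e₁ e₂)
    (he : List.Forall₂ (ERel n) es es') :
    KRel n (.callMod e₁ es :: K₁) (.callMod e₂ es' :: K₂) := by
  refine hK.push_of_not_try ⟨h₁.1, (ERel.scopedAll he).1⟩
    ⟨h₁.2.1, (ERel.scopedAll he).2⟩ id id (fun m hm vs ws h K' r' hs => ?_) ?_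
  · cases hs
    obtain _ | ⟨h, _ | _⟩ := h
    exact ⟨_, _, .sCallFun .., (h₁.mono hm.le).sim
      ((hK.mono hm.le).callFun (h.mono m.le_succ) (ERel.mono_list hm.le he))⟩
  · intro m hm K' r' hs
    cases hs

theorem KRel.apply {n es es' K₁ K₂} (hK : KRel n K₁ K₂) (he : List.Forall₂ (ERel n) es es') :
    KRel n (.apply es :: K₁) (.apply es' :: K₂) := by
  refine hK.push_of_not_try (ERel.scopedAll he).1 (ERel.scopedAll he).2 id id
    (fun m hm vs ws h K' r' hs => ?_) ?_
  · cases hs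
    obtain _ | ⟨h, _ | _⟩ := h
    exact ⟨_, _, .sAppParam .., RRel.box.sim ((hK.mono hm.le).params
      (.app (h.mono m.le_succ)) .nil (ERel.mono_list hm.le he) nofun)⟩
  · intro m hm K' r' hs
    cases hs

/-- Related bodies of a binder for the variables `xs`. -/
def BodyRel (n : ℕ) (xs : List Var) (e₁ e₂ : Exp) : Prop :=
  e₁.Scoped (varNames xs) ∧ e₂.Scoped (varNames xs) ∧
    ∀ m ≤ n, ∀ vs ws, vs.length = xs.length → List.Forall₂ (VRel m) vs ws →
      ERel m (e₁.subst (.ofVars xs vs)) (e₂.subst (.ofVars xs ws))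

theorem KRel.letIn {n xs e₁ e₂ K₁ K₂} (hK : KRel n K₁ K₂) (he : BodyRel n xs e₁ e₂) :
    KRel n (.letIn xs e₁ :: K₁) (.letIn xs e₂ :: K₂) := by
  refine hK.push_of_not_try he.1 he.2.1 id id (fun m hm vs ws h K' r' hs => ?_) ?_
  · cases hs with
    | pLet _ _ _ _ hl =>
      exact ⟨_, _, .pLet _ _ _ _ (h.length_eq ▸ hl),
        (he.2.2 m hm.le vs ws hl (VRel.mono_list m.le_succ h)).sim (hK.mono hm.le)⟩
  · intro m hm K' r' hs
    cases hs

theorem KRel.tryOf {n xs e₁ e₂ ys e₁' e₂' K₁ K₂} (hK : KRel n K₁ K₂) (he : BodyRel n xs e₁ e₂)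
    (he' : BodyRel n ys e₁' e₂') :
    KRel n (.tryOf xs e₁ ys e₁' :: K₁) (.tryOf xs e₂ ys e₂' :: K₂) := by
  refine hK.push ⟨he.1, he'.1⟩ ⟨he.2.1, he'.2.1⟩ (fun m hm vs ws h K' r' hs => ?_)
    (fun m hm x y h K' r' hs => ?_) ?_
  · cases hs with
    | pTry _ _ _ _ _ _ hl =>
      exact ⟨_, _, .pTry _ _ _ _ _ _ (h.length_eq ▸ hl),
        (he.2.2 m hm.le vs ws hl (VRel.mono_list m.le_succ h)).sim (hK.mono hm.le)⟩
  · cases hs with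
    | excTry =>
      have h' := h.mono m.le_succ
      exact ⟨_, _, .excTry .., (he'.2.2 m hm.le _ _ rfl (.cons (h.1 ▸ VRel.atom _ _)
        (.cons h'.2.1 (.cons h'.2.2 .nil)))).sim (hK.mono hm.le)⟩
    | excProp _ _ _ h => exact (h trivial).elim
  · intro m hm K' r' hs
    cases hs

/-! ## Pattern matching on related values -/

/-- Related bindings. -/
def BRel (n : ℕ) (p q : Var × Val) : Prop := p.1 = q.1 ∧ VRel n p.2 q.2

mutual

theorem Pat.matchVal_rel {n} : ∀ (p : Pat) {v w}, VRel n v w →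
    Option.Rel (List.Forall₂ (BRel n)) (p.matchVal v) (p.matchVal w)
  | .var x, _, _, h => by
      simp only [Pat.matchVal]
      exact .some (.cons ⟨rfl, h⟩ .nil)
  | .int i, _, _, h => by
      cases h.shape <;> simp only [Pat.matchVal]
      case int => exact ite_none_rel fun _ => .some .nil
      all_goals exact .none
  | .atom a, _, _, h => by
      cases h.shape <;> simp only [Pat.matchVal]
      case atom => exact ite_none_rel fun _ => .some .nil
      all_goals exact .none
  | .nil, _, _, h => by
      cases h.shape <;> simp only [Pat.matchVal]
      case nil => exact .some .nil
      all_goals exact .none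
  | .cons p q, _, _, h => by
      cases h.shape <;> simp only [Pat.matchVal]
      case cons h₁ h' =>
        exact (Pat.matchVal_rel p h₁).bind_rel fun _ _ hl =>
          (Pat.matchVal_rel q h').map_rel fun _ _ hl' => List.rel_append hl hl'
      all_goals exact .none
  | .tuple ps, _, _, h => by
      cases h.shape <;> simp only [Pat.matchVal]
      case tuple h' => exact Pat.matchList_rel ps h'
      all_goals exact .none
  | .map ps, _, _, h => by
      cases h.shape <;> simp only [Pat.matchVal]
      case map h' => exact Pat.matchPairs_rel ps h'
      all_goals exact .none

theorem Pat.matchList_rel {n} : ∀ (ps : List Pat) {vs ws}, List.Forall₂ (VRel n) vs ws →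
    Option.Rel (List.Forall₂ (BRel n)) (Pat.matchList ps vs) (Pat.matchList ps ws)
  | [], _, _, h => by
      cases h <;> simp only [Pat.matchList]
      · exact .some .nil
      · exact .none
  | p :: ps, _, _, h => by
      cases h <;> simp only [Pat.matchList]
      · exact .none
      case cons h h' =>
        exact (Pat.matchVal_rel p h).bind_rel fun _ _ hl =>
          (Pat.matchList_rel ps h').map_rel fun _ _ hl' => List.rel_append hl hl'

theorem Pat.matchPairs_rel {n} : ∀ (ps : List (Pat × Pat)) {vs ws},
    List.Forall₂ (PRel n) vs ws →
    Option.Rel (List.Forall₂ (BRel n)) (Pat.matchPairs ps vs) (Pat.matchPairs ps ws)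
  | [], _, _, h => by
      cases h <;> simp only [Pat.matchPairs]
      · exact .some .nil
      · exact .none
  | (p, q) :: ps, _, _, h => by
      cases h <;> simp only [Pat.matchPairs]
      · exact .none
      case cons h h' =>
        exact (Pat.matchVal_rel p h.1).bind_rel fun _ _ hl₁ =>
          (Pat.matchVal_rel q h.2).bind_rel fun _ _ hl₂ =>
            (Pat.matchPairs_rel ps h').map_rel fun _ _ hl₃ =>
              List.rel_append (List.rel_append hl₁ hl₂) hl₃

end

mutual

theorem Pat.matchVal_vars : ∀ (p : Pat) {v l}, p.matchVal v = some l → l.map Prod.fst = p.vars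
  | .var x, _, _, h => by
      simp only [Pat.matchVal, Option.some.injEq] at h
      subst h
      rfl
  | .int i, v, _, h => by
      cases v <;> simp [Pat.matchVal] at h
      simp [← h.2, Pat.vars]
  | .atom a, v, _, h => by
      cases v <;> simp [Pat.matchVal] at h
      simp [← h.2, Pat.vars]
  | .nil, v, _, h => by
      cases v <;> simp [Pat.matchVal] at h
      simp [h, Pat.vars]
  | .cons p q, v, _, h => by
      cases v <;> simp [Pat.matchVal, Option.bind_eq_some_iff] at h
      obtain ⟨l, hl, l', hl', rfl⟩ := h
      simp [Pat.vars, Pat.matchVal_vars p hl, Pat.matchVal_vars q hl']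
  | .tuple ps, v, _, h => by
      cases v <;> simp [Pat.matchVal] at h
      simp [Pat.vars, Pat.matchList_vars ps h]
  | .map ps, v, _, h => by
      cases v <;> simp [Pat.matchVal] at h
      simp [Pat.vars, Pat.matchPairs_vars ps h]

theorem Pat.matchList_vars : ∀ (ps : List Pat) {vs l}, Pat.matchList ps vs = some l →
    l.map Prod.fst = Pat.varsList ps
  | [], vs, _, h => by
      cases vs <;> simp [Pat.matchList] at h
      simp [h, Pat.varsList]
  | p :: ps, vs, _, h => by
      cases vs <;> simp [Pat.matchList, Option.bind_eq_some_iff] at h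
      obtain ⟨l, hl, l', hl', rfl⟩ := h
      simp [Pat.varsList, Pat.matchVal_vars p hl, Pat.matchList_vars ps hl']

theorem Pat.matchPairs_vars : ∀ (ps : List (Pat × Pat)) {vs l},
    Pat.matchPairs ps vs = some l → l.map Prod.fst = Pat.varsPairs ps
  | [], vs, _, h => by
      cases vs <;> simp [Pat.matchPairs] at h
      simp [h, Pat.varsPairs]
  | (p, q) :: ps, vs, _, h => by
      obtain _ | ⟨⟨k, v⟩, vs⟩ := vs <;> simp [Pat.matchPairs, Option.bind_eq_some_iff] at h
      obtain ⟨l₁, h₁, l₂, h₂, l₃, h₃, rfl⟩ := h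
      simp [Pat.varsPairs, Pat.matchVal_vars p h₁, Pat.matchVal_vars q h₂,
        Pat.matchPairs_vars ps h₃]

end

/-- Related clauses. -/
inductive ClauseRel (n : ℕ) : Clause → Clause → Prop
  | mk {ps g g' b b'}
      (hg : g.Scoped (varNames (Pat.varsList ps))) (hg' : g'.Scoped (varNames (Pat.varsList ps)))
      (hb : b.Scoped (varNames (Pat.varsList ps))) (hb' : b'.Scoped (varNames (Pat.varsList ps)))
      (h : ∀ m ≤ n, ∀ l l', l.map Prod.fst = Pat.varsList ps → List.Forall₂ (BRel m) l l' →
        ERel m (g.subst (.ofBindings l)) (g'.subst (.ofBindings l')) ∧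
          ERel m (b.subst (.ofBindings l)) (b'.subst (.ofBindings l'))) :
      ClauseRel n (.mk ps g b) (.mk ps g' b')

theorem ClauseRel.scopedAll {n cls cls'} (h : List.Forall₂ (ClauseRel n) cls cls') :
    Clause.ScopedAll cls ∅ ∧ Clause.ScopedAll cls' ∅ := by
  induction h with
  | nil => exact ⟨trivial, trivial⟩
  | cons h _ ih =>
    cases h with
    | mk hg hg' hb hb' h =>
      simp only [Clause.ScopedAll, Set.empty_union]
      exact ⟨⟨hg, hb, ih.1⟩, hg', hb', ih.2⟩

theorem KRel.caseGuard {n vs ws ps b b' cls cls' K₁ K₂} (hK : KRel n K₁ K₂)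
    (hv : List.Forall₂ (VRel n) vs ws) (hb : ERel n b b')
    (hc : Clause.ScopedAll cls ∅ ∧ Clause.ScopedAll cls' ∅)
    (hcls : KRel n (.caseOf cls :: K₁) (.caseOf cls' :: K₂)) :
    KRel n (.caseGuard vs ps b cls :: K₁) (.caseGuard ws ps b' cls' :: K₂) := by
  refine hK.push_of_not_try ⟨VRel.scopedAll_left hv, hb.1, hc.1⟩
    ⟨VRel.scopedAll_right hv, hb.2.1, hc.2⟩ id id (fun m hm us us' h K' r' hs => ?_) ?_
  · cases hs with
    | sCaseFalse =>
      obtain _ | ⟨h, _ | _⟩ := h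
      cases h.shape
      exact ⟨_, _, .sCaseFalse .., (RRel.vals (VRel.mono_list hm.le hv)).sim (hcls.mono hm.le)⟩
    | pCaseTrue =>
      obtain _ | ⟨h, _ | _⟩ := h
      cases h.shape
      exact ⟨_, _, .pCaseTrue .., (hb.mono hm.le).sim (hK.mono hm.le)⟩
  · intro m hm K' r' hs
    cases hs

theorem KRel.caseOf {n cls cls' K₁ K₂} (hK : KRel n K₁ K₂)
    (hc : List.Forall₂ (ClauseRel n) cls cls') :
    KRel n (.caseOf cls :: K₁) (.caseOf cls' :: K₂) := by
  induction hc with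
  | nil =>
    refine hK.push_of_not_try trivial trivial id id (fun m hm us us' h K' r' hs => ?_) ?_
    · cases hs with
      | excCase => exact ⟨_, _, .excCase .., (RRel.error _ (VRel.tuple_iff.2 .nil)).sim
          (hK.mono hm.le)⟩
    · intro m hm K' r' hs
      cases hs
  | cons h t ih =>
    refine hK.push_of_not_try (ClauseRel.scopedAll (.cons h t)).1
      (ClauseRel.scopedAll (.cons h t)).2 id id (fun m hm vs ws hv K' r' hs => ?_) ?_
    · cases h with
      | @mk ps _ _ _ _ _ _ _ _ h =>
        have hv' := VRel.mono_list m.le_succ hv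
        have hp := Pat.matchList_rel ps hv'
        generalize hw : Pat.matchList ps ws = o at hp
        cases hs with
        | sCaseFail _ _ _ _ _ _ hn =>
          rw [hn] at hp
          cases hp
          exact ⟨_, _, .sCaseFail _ _ _ _ _ _ hw, (RRel.vals hv').sim (ih.mono hm.le)⟩
        | sCaseSuccess _ _ _ _ _ _ l hl =>
          rw [hl] at hp
          cases hp with
          | some hp =>
            obtain ⟨hg, hb⟩ := h m hm.le _ _ (Pat.matchList_vars ps hl) hp
            exact ⟨_, _, .sCaseSuccess _ _ _ _ _ _ _ hw, hg.sim ((hK.mono hm.le).caseGuard hv' hb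
              (ClauseRel.scopedAll t) (ih.mono hm.le))⟩
    · intro m hm K' r' hs
      cases hs

/-! ## Compatibility of expressions -/

theorem ERel.of_step {n e₁ e₂} (c₁ : e₁.Closed) (c₂ : e₂.Closed)
    (h : ∀ m < n, ∀ K₁ K₂, KRel m K₁ K₂ → ∃ K₁' r₁' K₂' r₂', Step K₁ (.exp e₁) K₁' r₁' ∧
      Step K₂ (.exp e₂) K₂' r₂' ∧ Sim m K₁' r₁' K₂' r₂') : ERel n e₁ e₂ := by
  refine ⟨c₁, c₂, fun m hm K₁ K₂ hK ht => ?_⟩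
  obtain _ | m := m
  · obtain ⟨res, hres, h⟩ := ht
    cases h
    exact hres.elim
  · obtain ⟨K₁', r₁', K₂', r₂', h₁, h₂, hs⟩ := h m hm K₁ K₂ (KRel.mono m.le_succ hK)
    obtain ⟨k, hk, ht⟩ := ht.step h₁
    obtain rfl : m = k := by omega
    exact (hs m le_rfl ht).of_step h₂

/-! ## The fundamental property -/

/-- Substitutions that are defined on `Γ` and pointwise related. -/
def SubRel (n : ℕ) (Γ : Set Name) (σ τ : Subst) : Prop :=
  ∀ y, (σ y = none ∧ τ y = none ∧ y ∉ Γ) ∨ ∃ v w, σ y = some v ∧ τ y = some w ∧ VRel n v w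

theorem SubRel.closedRange {n Γ σ τ} (h : SubRel n Γ σ τ) :
    σ.ClosedRange ∧ τ.ClosedRange := by
  refine ⟨fun y u hu => ?_, fun y u hu => ?_⟩ <;>
    obtain ⟨h₁, h₂, -⟩ | ⟨v, w, h₁, h₂, hv⟩ := h y <;> simp_all
  · exact hv.closed_left
  · exact hv.closed_right

theorem SubRel.maps {n Γ σ τ} (h : SubRel n Γ σ τ) : σ.Maps Γ ∅ ∧ τ.Maps Γ ∅ := by
  refine ⟨⟨h.closedRange.1, fun y hy hn => ?_⟩, h.closedRange.2, fun y hy hn => ?_⟩ <;>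
    obtain ⟨-, -, h⟩ | ⟨v, w, h₁, h₂, hv⟩ := h y <;> simp_all

theorem SubRel.mono {m n Γ σ τ} (hm : m ≤ n) (h : SubRel n Γ σ τ) : SubRel m Γ σ τ := by
  intro y
  obtain h | ⟨v, w, h₁, h₂, hv⟩ := h y
  · exact .inl h
  · exact .inr ⟨v, w, h₁, h₂, hv.mono hm⟩

theorem SubRel.union {n Γ Δ σ τ σ' τ'} (h : SubRel n Γ σ τ) (h' : SubRel n Δ σ' τ') :
    SubRel n (Γ ∪ Δ) (σ.union σ') (τ.union τ') := by
  intro y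
  simp only [Subst.union]
  obtain ⟨h₁, h₂, h₃⟩ | ⟨v, w, h₁, h₂, hv⟩ := h y
  · obtain ⟨h₁', h₂', h₃'⟩ | ⟨v, w, h₁', h₂', hv⟩ := h' y
    · exact .inl (by simp [*])
    · exact .inr ⟨v, w, by simp [*], by simp [*], hv⟩
  · exact .inr ⟨v, w, by simp [*], by simp [*], hv⟩

theorem SubRel.erase {n Γ σ τ} (h : SubRel n Γ σ τ) (s : Set Name) :
    SubRel n (Γ \ s) (σ.erase s) (τ.erase s) := by
  intro y
  by_cases hs : y ∈ s
  · exact .inl (by simp [Subst.erase, hs])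
  · simpa [Subst.erase, hs] using h y

theorem SubRel.extend {n Γ s σ τ σ' τ'} (h : SubRel n Γ σ τ) (h' : SubRel n s σ' τ') :
    SubRel n (Γ ∪ s) ((σ.erase s).union σ') ((τ.erase s).union τ') := by
  simpa [Set.sdiff_union_self] using (h.erase s).union h'

theorem SubRel.ofBindings {n l l'} (h : List.Forall₂ (BRel n) l l') :
    SubRel n (varNames (l.map Prod.fst)) (.ofBindings l) (.ofBindings l') := by
  intro y
  cases y with
  | fid f k => exact .inl ⟨rfl, rfl, by simp [varNames]⟩
  | var x =>
    simp only [Subst.ofBindings]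
    induction h with
    | nil => exact .inl (by simp [varNames])
    | @cons p q l l' h _ ih =>
      obtain ⟨x₁, v⟩ := p
      obtain ⟨x₂, w⟩ := q
      obtain ⟨rfl : x₁ = x₂, hv⟩ := h
      by_cases hx : x = x₁
      · subst hx
        exact .inr ⟨v, w, by simp [List.lookup], by simp [List.lookup], hv⟩
      · have hb : (x == x₁) = false := by simpa using hx
        simp only [List.lookup, hb]
        obtain ⟨h₁, h₂, h₃⟩ | h := ih
        · exact .inl ⟨h₁, h₂, by simpa [varNames, hx] using h₃⟩
        · exact .inr h

theorem SubRel.ofVars {n} {xs : List Var} {vs ws : List Val} (hl : vs.length = xs.length)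
    (h : List.Forall₂ (VRel n) vs ws) :
    SubRel n (varNames xs) (.ofVars xs vs) (.ofVars xs ws) := by
  have hz : List.Forall₂ (BRel n) (xs.zip vs) (xs.zip ws) := by
    clear hl
    induction h generalizing xs with
    | nil => simp
    | cons h _ ih =>
      cases xs with
      | nil => exact .nil
      | cons x xs => exact .cons ⟨rfl, h⟩ ih
  simpa [Subst.ofVars, List.map_fst_zip hl.ge] using SubRel.ofBindings hz

theorem Subst.erase_erase (σ : Subst) (s t : Set Name) :
    (σ.erase s).erase t = σ.erase (s ∪ t) := by
  funext y
  by_cases hs : y ∈ s <;> by_cases ht : y ∈ t <;> simp [Subst.erase, hs, ht]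

theorem ClosItem.ScopedAll.of_mem {ext : List ClosItem} {Γ f xs e}
    (h : ClosItem.ScopedAll ext Γ) (hm : ClosItem.mk f xs e ∈ ext) :
    e.Scoped (Γ ∪ varNames xs) := by
  induction ext with
  | nil => simp at hm
  | cons c ext ih =>
    obtain ⟨g, ys, e'⟩ := c
    obtain hm | hm := List.mem_cons.1 hm
    · obtain ⟨rfl, rfl, rfl⟩ := ClosItem.mk.inj hm
      exact h.1
    · exact ih h.2 hm

/-- Related substitutions give related instances of `e`. -/
def Exp.Fundamental (e : Exp) (Γ : Set Name) : Prop :=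
  ∀ n σ τ, SubRel n Γ σ τ → ERel n (e.subst σ) (e.subst τ)

theorem clos_rel {n Γ ext xs e σ τ} (hs : (Val.clos ext xs e).Scoped Γ)
    (he : e.Fundamental (Γ ∪ namesOf ext ∪ varNames xs)) (h : SubRel n Γ σ τ)
    (hext : ∀ m < n, SubRel m (namesOf ext)
      (mkClosList (ClosItem.substAll ext (σ.erase (namesOf ext))))
      (mkClosList (ClosItem.substAll ext (τ.erase (namesOf ext))))) :
    VRel n ((Val.clos ext xs e).subst σ) ((Val.clos ext xs e).subst τ) := by
  have h₁ := Val.Scoped.subst h.maps.1 hs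
  have h₂ := Val.Scoped.subst h.maps.2 hs
  rw [Val.subst] at h₁ h₂ ⊢
  rw [Val.subst]
  refine VRel.clos_iff.2 ⟨h₁, h₂, rfl, fun m hm vs ws hl hv => ?_⟩
  have hr := (h.mono hm.le).extend ((hext m hm).union (SubRel.ofVars hl hv))
  rw [Exp.subst_subst _ (h.closedRange.1.erase _), Exp.subst_subst _ (h.closedRange.2.erase _)]
  rw [← Set.union_assoc] at hr
  exact he _ _ _ hr

theorem findClos_cases (all all' : List ClosItem) (σ τ : Subst) (y : Name)
    (ext : List ClosItem) :
    (findClos all (ClosItem.substAll ext σ) y = none ∧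
      findClos all' (ClosItem.substAll ext τ) y = none ∧ y ∉ namesOf ext) ∨
    ∃ f xs e, ClosItem.mk f xs e ∈ ext ∧
      findClos all (ClosItem.substAll ext σ) y =
        some (.clos all xs (e.subst (σ.erase (varNames xs)))) ∧
      findClos all' (ClosItem.substAll ext τ) y =
        some (.clos all' xs (e.subst (τ.erase (varNames xs)))) := by
  induction ext with
  | nil => exact .inl ⟨rfl, rfl, by simp [namesOf]⟩
  | cons c ext ih =>
    obtain ⟨f, xs, e⟩ := c
    simp only [ClosItem.substAll, findClos]
    by_cases hy : y = .fid f xs.length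
    · exact .inr ⟨f, xs, e, by simp, by simp [hy], by simp [hy]⟩
    · simp only [hy, if_false]
      obtain ⟨h₁, h₂, h₃⟩ | ⟨g, ys, e', hm, h⟩ := ih
      · exact .inl ⟨h₁, h₂, by simpa [namesOf, ClosItem.name, hy] using h₃⟩
      · exact .inr ⟨g, ys, e', List.mem_cons_of_mem _ hm, h⟩

theorem mkClosList_rel {Γ ext} (hs : ClosItem.ScopedAll ext (Γ ∪ namesOf ext))
    (he : ∀ f xs e, ClosItem.mk f xs e ∈ ext →
      e.Fundamental (Γ ∪ namesOf ext ∪ varNames xs)) (n : ℕ) {σ τ} (h : SubRel n Γ σ τ) :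
    SubRel n (namesOf ext) (mkClosList (ClosItem.substAll ext (σ.erase (namesOf ext))))
      (mkClosList (ClosItem.substAll ext (τ.erase (namesOf ext)))) := by
  induction n using Nat.strong_induction_on with
  | _ n ih =>
    intro y
    obtain h' | ⟨f, xs, e, hm, h₁, h₂⟩ := findClos_cases
      (ClosItem.substAll ext (σ.erase (namesOf ext)))
      (ClosItem.substAll ext (τ.erase (namesOf ext)))
      (σ.erase (namesOf ext)) (τ.erase (namesOf ext)) y ext
    · exact .inl h'
    · have hc := clos_rel (xs := xs) ⟨hs, hs.of_mem hm⟩ (he f xs e hm) h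
        fun m hm => ih m hm (h.mono hm.le)
      rw [Subst.erase_erase] at h₁ h₂
      rw [Val.subst, Val.subst] at hc
      exact .inr ⟨_, _, h₁, h₂, hc⟩

theorem BodyRel.of_fundamental {n Γ xs} {e : Exp} {σ τ} (hs : e.Scoped (Γ ∪ varNames xs))
    (he : e.Fundamental (Γ ∪ varNames xs)) (h : SubRel n Γ σ τ) :
    BodyRel n xs (e.subst (σ.erase (varNames xs))) (e.subst (τ.erase (varNames xs))) := by
  refine ⟨?_, ?_, fun m hm vs ws hl hv => ?_⟩
  · simpa using Exp.Scoped.subst (h.maps.1.erase (varNames xs)) hs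
  · simpa using Exp.Scoped.subst (h.maps.2.erase (varNames xs)) hs
  · rw [Exp.subst_subst _ (h.closedRange.1.erase _), Exp.subst_subst _ (h.closedRange.2.erase _)]
    exact he _ _ _ ((h.mono hm).extend (.ofVars hl hv))

theorem ClauseRel.of_fundamental {n Γ ps} {g b : Exp} {σ τ}
    (hg : g.Scoped (Γ ∪ varNames (Pat.varsList ps)))
    (hb : b.Scoped (Γ ∪ varNames (Pat.varsList ps)))
    (fg : g.Fundamental (Γ ∪ varNames (Pat.varsList ps)))
    (fb : b.Fundamental (Γ ∪ varNames (Pat.varsList ps))) (h : SubRel n Γ σ τ) :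
    ClauseRel n
      (.mk ps (g.subst (σ.erase (varNames (Pat.varsList ps))))
        (b.subst (σ.erase (varNames (Pat.varsList ps)))))
      (.mk ps (g.subst (τ.erase (varNames (Pat.varsList ps))))
        (b.subst (τ.erase (varNames (Pat.varsList ps))))) := by
  have m₁ := h.maps.1.erase (varNames (Pat.varsList ps))
  have m₂ := h.maps.2.erase (varNames (Pat.varsList ps))
  rw [Set.empty_union] at m₁ m₂
  refine .mk (hg.subst m₁) (hg.subst m₂) (hb.subst m₁) (hb.subst m₂) fun m hm l l' hl hr => ?_
  have hr' := (h.mono hm).extend (hl ▸ SubRel.ofBindings hr)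
  simp only [Exp.subst_subst _ (h.closedRange.1.erase _),
    Exp.subst_subst _ (h.closedRange.2.erase _)]
  exact ⟨fg _ _ _ hr', fb _ _ _ hr'⟩

theorem ERel.val {n v w} (h : VRel n v w) : ERel n (.val v) (.val w) :=
  .of_step h.closed_left h.closed_right fun _ hm _ _ hK =>
    ⟨_, _, _, _, .pValue .., .pValue .., (RRel.one (h.mono hm.le)).sim hK⟩

theorem length_unpair (kvs : List (Exp × Exp)) : (unpair kvs).length = 2 * kvs.length := by
  induction kvs with
  | nil => rfl
  | cons p kvs ih =>
    simp only [unpair, List.length_cons, ih]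
    ring

theorem ERel.params_box {n i es es'} (hi : ∀ n, IdRel n i i) (hne : i ≠ .map)
    (he : List.Forall₂ (ERel n) es es') {m} (hm : m < n) {K₁ K₂} (hK : KRel m K₁ K₂) :
    Sim m (.params i [] es :: K₁) .box (.params i [] es' :: K₂) .box :=
  RRel.box.sim (hK.params (hi m) .nil (ERel.mono_list hm.le he) fun h => (hne h).elim)

mutual

theorem Val.fundamental : ∀ (v : Val) {Γ n σ τ}, v.Scoped Γ → SubRel n Γ σ τ →
    VRel n (v.subst σ) (v.subst τ)
  | .int _, _, _, _, _, _, _ => VRel.int _ _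
  | .atom _, _, _, _, _, _, _ => VRel.atom _ _
  | .var x, _, _, _, _, hs, h => by
      obtain ⟨-, -, h⟩ | ⟨v, w, h₁, h₂, hv⟩ := h (.var x)
      · exact (h hs).elim
      · rwa [Val.subst, Val.subst, h₁, h₂]
  | .fid f k, _, _, _, _, hs, h => by
      obtain ⟨-, -, h⟩ | ⟨v, w, h₁, h₂, hv⟩ := h (.fid f k)
      · exact (h hs).elim
      · rwa [Val.subst, Val.subst, h₁, h₂]
  | .clos ext xs e, _, _, _, _, hs, h =>
      clos_rel hs (fun _ _ _ hr => Exp.fundamental e hs.2 hr) h fun m hm =>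
        mkClosList_rel hs.1 (ClosItem.fundamental ext hs.1) m (h.mono hm.le)
  | .cons v w, _, _, _, _, hs, h => by
      rw [Val.subst, Val.subst]
      exact VRel.cons_iff.2 ⟨Val.fundamental v hs.1 h, Val.fundamental w hs.2 h⟩
  | .nil, _, _, _, _, _, _ => VRel.nil _
  | .tuple vs, _, _, _, _, hs, h => by
      rw [Val.subst, Val.subst]
      exact VRel.tuple_iff.2 (Val.fundamental_list vs hs h)
  | .map kvs, _, _, _, _, hs, h => by
      rw [Val.subst, Val.subst]
      exact VRel.map_iff.2 (Val.fundamental_pairs kvs hs h)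

theorem Val.fundamental_list : ∀ (vs : List Val) {Γ n σ τ}, Val.ScopedAll vs Γ →
    SubRel n Γ σ τ → List.Forall₂ (VRel n) (Val.substAll vs σ) (Val.substAll vs τ)
  | [], _, _, _, _, _, _ => .nil
  | v :: vs, _, _, _, _, hs, h =>
      .cons (Val.fundamental v hs.1 h) (Val.fundamental_list vs hs.2 h)

theorem Val.fundamental_pairs : ∀ (kvs : List (Val × Val)) {Γ n σ τ}, Val.ScopedPairs kvs Γ →
    SubRel n Γ σ τ → List.Forall₂ (PRel n) (Val.substPairs kvs σ) (Val.substPairs kvs τ)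
  | [], _, _, _, _, _, _ => .nil
  | (k, v) :: kvs, _, _, _, _, hs, h =>
      .cons ⟨Val.fundamental k hs.1 h, Val.fundamental v hs.2.1 h⟩
        (Val.fundamental_pairs kvs hs.2.2 h)

theorem ClosItem.fundamental : ∀ (ext : List ClosItem) {Γ}, ClosItem.ScopedAll ext Γ →
    ∀ f xs e, ClosItem.mk f xs e ∈ ext → e.Fundamental (Γ ∪ varNames xs)
  | [], _, _, _, _, _, hm => by simp at hm
  | .mk f xs e :: ext, _, hs, f', xs', e', hm => by
      obtain hm | hm := List.mem_cons.1 hm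
      · obtain ⟨rfl, rfl, rfl⟩ := ClosItem.mk.inj hm
        exact fun _ _ _ hr => Exp.fundamental _ hs.1 hr
      · exact ClosItem.fundamental ext hs.2 f' xs' e' hm

theorem Clause.fundamental : ∀ (cls : List Clause) {Γ n σ τ}, Clause.ScopedAll cls Γ →
    SubRel n Γ σ τ → List.Forall₂ (ClauseRel n) (Clause.substAll cls σ) (Clause.substAll cls τ)
  | [], _, _, _, _, _, _ => .nil
  | .mk _ g b :: cls, _, _, _, _, hs, h =>
      .cons (.of_fundamental hs.1 hs.2.1 (fun _ _ _ hr => Exp.fundamental g hs.1 hr)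
        (fun _ _ _ hr => Exp.fundamental b hs.2.1 hr) h) (Clause.fundamental cls hs.2.2 h)

theorem NonVal.fundamental : ∀ (e : NonVal) {Γ n σ τ}, e.Scoped Γ → SubRel n Γ σ τ →
    ERel n (.nonval (e.subst σ)) (.nonval (e.subst τ))
  | .lam xs e, Γ, _, _, _, hs, h => by
      refine .of_step (NonVal.Scoped.subst h.maps.1 hs) (NonVal.Scoped.subst h.maps.2 hs)
        fun m hm K₁ K₂ hK => ?_
      have hn : namesOf [] = ∅ := by simp [namesOf]
      have hΓ : Γ ∪ namesOf [] ∪ varNames xs = Γ ∪ varNames xs := by rw [hn, Set.union_empty]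
      have hv := clos_rel (ext := []) (xs := xs) (e := e) ⟨trivial, hΓ ▸ hs⟩
        (fun _ _ _ hr => Exp.fundamental e hs (hΓ ▸ hr)) (h.mono hm.le)
        fun m _ => mkClosList_rel (ext := []) trivial (by simp) m (h.mono (by omega))
      simp only [Val.subst, hn, Set.empty_union, ClosItem.substAll] at hv
      exact ⟨_, _, _, _, .pFun .., .pFun .., (RRel.one hv).sim hK⟩
  | .values es, _, _, _, _, hs, h =>
      .of_step (NonVal.Scoped.subst h.maps.1 hs) (NonVal.Scoped.subst h.maps.2 hs)
        fun _ hm _ _ hK => ⟨_, _, _, _, .sVals .., .sVals ..,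
          ERel.params_box (fun _ => .values) nofun (Exp.fundamental_list es hs h) hm hK⟩
  | .cons e₁ e₂, _, _, _, _, hs, h =>
      .of_step (NonVal.Scoped.subst h.maps.1 hs) (NonVal.Scoped.subst h.maps.2 hs)
        fun _ hm _ _ hK => ⟨_, _, _, _, .sConsTail .., .sConsTail ..,
          ((Exp.fundamental e₂ hs.2 h).mono hm.le).sim
            (hK.consTail ((Exp.fundamental e₁ hs.1 h).mono hm.le))⟩
  | .tuple es, _, _, _, _, hs, h =>
      .of_step (NonVal.Scoped.subst h.maps.1 hs) (NonVal.Scoped.subst h.maps.2 hs)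
        fun _ hm _ _ hK => ⟨_, _, _, _, .sTuple .., .sTuple ..,
          ERel.params_box (fun _ => .tuple) nofun (Exp.fundamental_list es hs h) hm hK⟩
  | .map [], _, _, _, _, hs, h =>
      .of_step (NonVal.Scoped.subst h.maps.1 hs) (NonVal.Scoped.subst h.maps.2 hs)
        fun _ _ _ _ hK => ⟨_, _, _, _, .pMap₀ .., .pMap₀ ..,
          (RRel.one (VRel.map_iff.2 .nil)).sim hK⟩
  | .map ((ek, ev) :: kvs), _, _, _, _, hs, h =>
      .of_step (NonVal.Scoped.subst h.maps.1 hs) (NonVal.Scoped.subst h.maps.2 hs)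
        fun _ hm _ _ hK => ⟨_, _, _, _, .sMap .., .sMap ..,
          ((Exp.fundamental ek hs.1 h).mono hm.le).sim (hK.params .map .nil
            (ERel.mono_list hm.le (.cons (Exp.fundamental ev hs.2.1 h)
              (Exp.fundamental_pairs kvs hs.2.2 h)))
            fun _ => ⟨(Exp.substPairs kvs _).length + 1, by
              simp only [List.length_cons, List.length_nil, length_unpair]
              ring⟩)⟩
  | .call em ef es, _, _, _, _, hs, h =>
      .of_step (NonVal.Scoped.subst h.maps.1 hs) (NonVal.Scoped.subst h.maps.2 hs)
        fun _ hm _ _ hK => ⟨_, _, _, _, .sCallMod .., .sCallMod ..,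
          ((Exp.fundamental em hs.1 h).mono hm.le).sim
            (hK.callMod ((Exp.fundamental ef hs.2.1 h).mono hm.le)
              (ERel.mono_list hm.le (Exp.fundamental_list es hs.2.2 h)))⟩
  | .primop a es, _, _, _, _, hs, h =>
      .of_step (NonVal.Scoped.subst h.maps.1 hs) (NonVal.Scoped.subst h.maps.2 hs)
        fun _ hm _ _ hK => ⟨_, _, _, _, .sPrimOp .., .sPrimOp ..,
          ERel.params_box (fun _ => .primop a) nofun (Exp.fundamental_list es hs h) hm hK⟩
  | .apply e es, _, _, _, _, hs, h =>
      .of_step (NonVal.Scoped.subst h.maps.1 hs) (NonVal.Scoped.subst h.maps.2 hs)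
        fun _ hm _ _ hK => ⟨_, _, _, _, .sApp .., .sApp ..,
          ((Exp.fundamental e hs.1 h).mono hm.le).sim
            (hK.apply (ERel.mono_list hm.le (Exp.fundamental_list es hs.2 h)))⟩
  | .case e cls, _, _, _, _, hs, h =>
      .of_step (NonVal.Scoped.subst h.maps.1 hs) (NonVal.Scoped.subst h.maps.2 hs)
        fun _ hm _ _ hK => ⟨_, _, _, _, .sCase .., .sCase ..,
          ((Exp.fundamental e hs.1 h).mono hm.le).sim
            (hK.caseOf (Clause.fundamental cls hs.2 (h.mono hm.le)))⟩
  | .letIn _ e₁ e₂, _, _, _, _, hs, h =>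
      .of_step (NonVal.Scoped.subst h.maps.1 hs) (NonVal.Scoped.subst h.maps.2 hs)
        fun _ hm _ _ hK => ⟨_, _, _, _, .sLet .., .sLet ..,
          ((Exp.fundamental e₁ hs.1 h).mono hm.le).sim
            (hK.letIn (.of_fundamental hs.2 (fun _ _ _ hr => Exp.fundamental e₂ hs.2 hr)
              (h.mono hm.le)))⟩
  | .seq e₁ e₂, _, _, _, _, hs, h =>
      .of_step (NonVal.Scoped.subst h.maps.1 hs) (NonVal.Scoped.subst h.maps.2 hs)
        fun _ hm _ _ hK => ⟨_, _, _, _, .sSeq .., .sSeq ..,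
          ((Exp.fundamental e₁ hs.1 h).mono hm.le).sim
            (hK.seq ((Exp.fundamental e₂ hs.2 h).mono hm.le))⟩
  | .letrec ext e, _, _, _, _, hs, h => by
      refine .of_step (NonVal.Scoped.subst h.maps.1 hs) (NonVal.Scoped.subst h.maps.2 hs)
        fun m hm K₁ K₂ hK => ⟨_, _, _, _, .pLetRec .., .pLetRec .., ?_⟩
      rw [Exp.subst_subst _ (h.closedRange.1.erase _),
        Exp.subst_subst _ (h.closedRange.2.erase _)]
      have hr := (h.mono hm.le).extend (mkClosList_rel hs.1
        (ClosItem.fundamental ext hs.1) m (h.mono hm.le))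
      exact (Exp.fundamental e hs.2 hr).sim hK
  | .tryOf e₁ _ e₂ _ e₃, _, _, _, _, hs, h =>
      .of_step (NonVal.Scoped.subst h.maps.1 hs) (NonVal.Scoped.subst h.maps.2 hs)
        fun _ hm _ _ hK => ⟨_, _, _, _, .sTry .., .sTry ..,
          ((Exp.fundamental e₁ hs.1 h).mono hm.le).sim
            (hK.tryOf (.of_fundamental hs.2.1 (fun _ _ _ hr => Exp.fundamental e₂ hs.2.1 hr)
              (h.mono hm.le)) (.of_fundamental hs.2.2
                (fun _ _ _ hr => Exp.fundamental e₃ hs.2.2 hr) (h.mono hm.le)))⟩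

theorem Exp.fundamental : ∀ (e : Exp) {Γ n σ τ}, e.Scoped Γ → SubRel n Γ σ τ →
    ERel n (e.subst σ) (e.subst τ)
  | .nonval e, _, _, _, _, hs, h => NonVal.fundamental e hs h
  | .val v, _, _, _, _, hs, h => ERel.val (Val.fundamental v hs h)

theorem Exp.fundamental_list : ∀ (es : List Exp) {Γ n σ τ}, Exp.ScopedAll es Γ →
    SubRel n Γ σ τ → List.Forall₂ (ERel n) (Exp.substAll es σ) (Exp.substAll es τ)
  | [], _, _, _, _, _, _ => .nil
  | e :: es, _, _, _, _, hs, h =>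
      .cons (Exp.fundamental e hs.1 h) (Exp.fundamental_list es hs.2 h)

theorem Exp.fundamental_pairs : ∀ (kvs : List (Exp × Exp)) {Γ n σ τ}, Exp.ScopedPairs kvs Γ →
    SubRel n Γ σ τ →
    List.Forall₂ (ERel n) (unpair (Exp.substPairs kvs σ)) (unpair (Exp.substPairs kvs τ))
  | [], _, _, _, _, _, _ => .nil
  | (k, v) :: kvs, _, _, _, _, hs, h =>
      .cons (Exp.fundamental k hs.1 h) (.cons (Exp.fundamental v hs.2.1 h)
        (Exp.fundamental_pairs kvs hs.2.2 h))

end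

theorem VRel.refl {v : Val} (h : v.Closed) (n : ℕ) : VRel n v v := by
  obtain ⟨σ, hσ⟩ : ∃ σ : Subst, SubRel n ∅ σ σ :=
    ⟨fun _ => none, fun _ => .inl ⟨rfl, rfl, id⟩⟩
  have := Val.fundamental v h hσ
  rwa [h.subst_eq] at this

/-! ## Frame stacks that observe values -/

/-- The CIU preorder on values. -/
def CIUVal (v w : Val) : Prop := CIU (.exp (.val v)) (.exp (.val w))

/-- An expression whose evaluation is stuck. -/
def stuckExp : Exp := .nonval (.letIn [] (.val .nil) (.val .nil))

theorem not_term_stuckExp (K : FrameStack) : ¬ Term K (.exp stuckExp) := by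
  intro h
  have h := (h.step (.sLet ..)).step (.pValue ..)
  obtain ⟨_, _, hs, -⟩ := h.exists_step
  cases hs with
  | pLet _ _ _ _ hl => simp at hl

/-- `case □ of p → b; _ → stuck end` -/
def testFrame (p : Pat) (b : Val) : Frame :=
  .caseOf [.mk [p] (.val (.atom atTrue)) (.val b), .mk [.var 0] (.val (.atom atTrue)) stuckExp]

theorem testFrame_closed {p : Pat} {b : Val} (h : b.Scoped (varNames p.vars)) :
    (testFrame p b).Closed := by
  simp [testFrame, Frame.Closed, Clause.ScopedAll, Exp.Scoped, Val.Scoped, stuckExp,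
    NonVal.Scoped, Pat.varsList, h]

theorem term_case_iff {K ps b cls vs l} (h : Pat.matchList ps vs = some l) :
    Term (.caseOf (.mk ps (.val (.atom atTrue)) b :: cls) :: K) (.vals vs) ↔
      Term K (.exp (b.subst (.ofBindings l))) := by
  rw [(Step.sCaseSuccess _ _ _ _ _ _ _ h).term_iff]
  simp only [Exp.subst, Val.subst]
  rw [(Step.pValue ..).term_iff, (Step.pCaseTrue ..).term_iff]

theorem term_testFrame_iff {K p b v} : Term (testFrame p b :: K) (.vals [v]) ↔
    ∃ l, p.matchVal v = some l ∧ Term K (.exp (.val (b.subst (.ofBindings l)))) := by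
  cases h : p.matchVal v with
  | some l =>
    have hl : Pat.matchList [p] [v] = some l := by simp [Pat.matchList, h]
    rw [testFrame, term_case_iff hl]
    simp [Exp.subst]
  | none =>
    have hl : Pat.matchList [p] [v] = none := by simp [Pat.matchList, h]
    have hl' : Pat.matchList [.var 0] [v] = some [(0, v)] := by
      simp [Pat.matchList, Pat.matchVal]
    rw [testFrame, (Step.sCaseFail _ _ _ _ _ _ hl).term_iff, term_case_iff hl']
    simp only [stuckExp, Exp.subst, NonVal.subst, Val.subst, reduceCtorEq, false_and,
      exists_false, iff_false]
    exact not_term_stuckExp K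

theorem term_nil_vals (vs : List Val) : Term [] (.vals vs) := ⟨0, .vals vs, trivial, .refl ..⟩

theorem lookup_isSome_iff {l : List (Var × Val)} {x : Var} :
    (l.lookup x).isSome ↔ x ∈ l.map Prod.fst := by
  induction l with
  | nil => simp
  | cons p l ih =>
    obtain ⟨y, v⟩ := p
    by_cases hx : x = y
    · simp [List.lookup, hx]
    · have hb : (x == y) = false := by simpa using hx
      simp only [List.lookup, hb, ih]
      simp [hx]

theorem Pat.matchVal_lookup_closed {p : Pat} {v l x u} (hv : v.Closed)
    (h : p.matchVal v = some l) (hx : l.lookup x = some u) : u.Closed := by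
  have hr := p.matchVal_rel (VRel.refl hv 0)
  rw [h] at hr
  cases hr with
  | some hr => exact (SubRel.ofBindings hr).closedRange.1 (.var x) u hx

theorem CIUVal.matchVal {v w : Val} (h : CIUVal v w) {p : Pat} {l} (hl : p.matchVal v = some l) :
    ∃ l', p.matchVal w = some l' ∧
      ∀ x u, l.lookup x = some u → ∃ u', l'.lookup x = some u' ∧ CIUVal u u' := by
  have key : ∀ b : Val, b.Scoped (varNames p.vars) → ∀ K : FrameStack, K.Closed →
      Term K (.exp (.val (b.subst (.ofBindings l)))) →
      ∃ l', p.matchVal w = some l' ∧ Term K (.exp (.val (b.subst (.ofBindings l')))) := by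
    intro b hb K hK ht
    have := h.2.2 (testFrame p b :: K) (.cons (testFrame_closed hb) hK)
    rw [(Step.pValue ..).term_iff, (Step.pValue ..).term_iff, term_testFrame_iff,
      term_testFrame_iff] at this
    exact this ⟨l, hl, ht⟩
  obtain ⟨l', hl', -⟩ := key .nil trivial [] (by simp [FrameStack.Closed])
    ((term_nil_vals _).of_step (.pValue ..))
  refine ⟨l', hl', fun x u hx => ?_⟩
  have hmem : x ∈ p.vars := by
    rw [← p.matchVal_vars hl, ← lookup_isSome_iff, hx]
    rfl
  obtain ⟨u', hu'⟩ : ∃ u', l'.lookup x = some u' := by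
    rwa [← Option.isSome_iff_exists, lookup_isSome_iff, p.matchVal_vars hl']
  refine ⟨u', hu', Pat.matchVal_lookup_closed h.1 hl hx,
    Pat.matchVal_lookup_closed h.2.1 hl' hu', fun K hK ht => ?_⟩
  obtain ⟨l'', hl'', ht'⟩ := key (.var x) ⟨x, hmem, rfl⟩ K hK
    (by simpa [Val.subst, Subst.ofBindings, hx] using ht)
  obtain rfl : l' = l'' := by simpa [hl'] using hl''
  simpa [Val.subst, Subst.ofBindings, hu'] using ht'

/-! ## Components of tuples and maps -/

theorem forall₂_of_lookup {R : Val → Val → Prop} {vs ws : List Val} (s : ℕ)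
    (hl : vs.length = ws.length)
    (h : ∀ x u, ((List.range' s vs.length).zip vs).lookup x = some u →
      ∃ u', ((List.range' s ws.length).zip ws).lookup x = some u' ∧ R u u') :
    List.Forall₂ R vs ws := by
  induction vs generalizing ws s with
  | nil =>
    cases ws with
    | nil => exact .nil
    | cons w ws => simp at hl
  | cons v vs ih =>
    cases ws with
    | nil => simp at hl
    | cons w ws =>
      simp only [List.length_cons, List.range'_succ, List.zip_cons_cons] at h
      refine .cons ?_ (ih (s + 1) (by simpa using hl) fun x u hx => ?_)
      · obtain ⟨u', hu', hr⟩ := h s v (by simp [List.lookup])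
        obtain rfl : w = u' := by simpa [List.lookup] using hu'
        exact hr
      · have hs : x ≠ s := by
          have hm : x ∈ ((List.range' (s + 1) vs.length).zip vs).map Prod.fst := by
            rw [← lookup_isSome_iff, hx]
            rfl
          rw [List.map_fst_zip (by simp), List.mem_range'_1] at hm
          omega
        have hb : (x == s) = false := by simpa using hs
        simpa [List.lookup, hb] using h x u (by simpa [List.lookup, hb] using hx)

theorem matchList_vars_iff {s k : ℕ} {vs l} :
    Pat.matchList ((List.range' s k).map .var) vs = some l ↔
      k = vs.length ∧ l = (List.range' s vs.length).zip vs := by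
  induction vs generalizing s k l with
  | nil => cases k <;> simp [List.range'_succ, Pat.matchList, eq_comm]
  | cons v vs ih =>
    cases k with
    | zero => simp [Pat.matchList]
    | succ k =>
      simp only [List.range'_succ, List.map_cons, Pat.matchList, Pat.matchVal, Option.bind_some,
        Option.map_eq_some_iff, ih, List.length_cons, Nat.add_right_cancel_iff,
        List.zip_cons_cons, List.singleton_append]
      constructor
      · rintro ⟨_, ⟨rfl, rfl⟩, rfl⟩
        exact ⟨rfl, rfl⟩
      · rintro ⟨rfl, rfl⟩
        exact ⟨_, ⟨rfl, rfl⟩, rfl⟩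

/-- Pairs of distinct variables. -/
def varPairs : ℕ → ℕ → List (Pat × Pat)
  | _, 0 => []
  | s, k + 1 => (.var s, .var (s + 1)) :: varPairs (s + 2) k

/-- The alternating list of the keys and values of a map. -/
def flatten : List (Val × Val) → List Val
  | [] => []
  | (k, v) :: l => k :: v :: flatten l

theorem matchPairs_vars_iff {s k : ℕ} {kvs l} :
    Pat.matchPairs (varPairs s k) kvs = some l ↔
      k = kvs.length ∧ l = (List.range' s (flatten kvs).length).zip (flatten kvs) := by
  induction kvs generalizing s k l with
  | nil => cases k <;> simp [varPairs, flatten, Pat.matchPairs, eq_comm]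
  | cons p kvs ih =>
    obtain ⟨k', v⟩ := p
    cases k with
    | zero => simp [varPairs, Pat.matchPairs]
    | succ k =>
      simp only [varPairs, flatten, List.range'_succ, Pat.matchPairs, Pat.matchVal,
        Option.bind_some, Option.map_eq_some_iff, ih, List.length_cons,
        Nat.add_right_cancel_iff, List.zip_cons_cons, List.cons_append]
      constructor
      · rintro ⟨_, ⟨rfl, rfl⟩, rfl⟩
        exact ⟨rfl, rfl⟩
      · rintro ⟨rfl, rfl⟩
        exact ⟨_, ⟨rfl, rfl⟩, rfl⟩

theorem length_flatten (kvs : List (Val × Val)) : (flatten kvs).length = 2 * kvs.length := by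
  induction kvs with
  | nil => rfl
  | cons p kvs ih =>
    simp only [flatten, List.length_cons, ih]
    ring

theorem CIUVal.tuple {vs w} (h : CIUVal (.tuple vs) w) :
    ∃ ws, w = .tuple ws ∧ List.Forall₂ CIUVal vs ws := by
  obtain ⟨l', hl', hx⟩ := h.matchVal (p := .tuple ((List.range' 0 vs.length).map .var))
    (by simpa only [Pat.matchVal] using matchList_vars_iff.2 ⟨rfl, rfl⟩)
  cases w <;> simp only [Pat.matchVal, reduceCtorEq] at hl'
  obtain ⟨hl, rfl⟩ := matchList_vars_iff.1 hl'
  exact ⟨_, rfl, forall₂_of_lookup 0 hl hx⟩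

theorem CIUVal.map {kvs w} (h : CIUVal (.map kvs) w) :
    ∃ kvs', w = .map kvs' ∧ List.Forall₂ CIUVal (flatten kvs) (flatten kvs') := by
  obtain ⟨l', hl', hx⟩ := h.matchVal (p := .map (varPairs 0 kvs.length))
    (by simpa only [Pat.matchVal] using matchPairs_vars_iff.2 ⟨rfl, rfl⟩)
  cases w <;> simp only [Pat.matchVal, reduceCtorEq] at hl'
  obtain ⟨hl, rfl⟩ := matchPairs_vars_iff.1 hl'
  exact ⟨_, rfl, forall₂_of_lookup 0 (by simp [length_flatten, hl]) hx⟩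

theorem CIUVal.cons {v v' w} (h : CIUVal (.cons v v') w) :
    ∃ u u', w = .cons u u' ∧ CIUVal v u ∧ CIUVal v' u' := by
  obtain ⟨l', hl', hx⟩ := h.matchVal (p := .cons (.var 0) (.var 1)) (l := [(0, v), (1, v')])
    (by simp [Pat.matchVal])
  cases w <;> simp only [Pat.matchVal, reduceCtorEq] at hl'
  case cons u u' =>
    simp only [Option.map_some, Option.bind_some, Option.some.injEq] at hl'
    subst hl'
    refine ⟨u, u', rfl, ?_, ?_⟩
    · obtain ⟨t, ht, hc⟩ := hx 0 v (by simp [List.lookup])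
      obtain rfl : u = t := by simpa [List.lookup] using ht
      exact hc
    · obtain ⟨t, ht, hc⟩ := hx 1 v' (by simp [List.lookup])
      obtain rfl : u' = t := by simpa [List.lookup] using ht
      exact hc

/-! ## Closures -/

theorem term_params_iff {K id us r} : ∀ {vs u}, eval id (vs ++ u :: us) = some r →
    (Term (.params id vs (us.map .val) :: K) (.vals [u]) ↔ Term K r) := by
  induction us with
  | nil => exact fun h => (Step.pParams _ _ _ _ _ h).term_iff
  | cons u' us ih =>
    intro vs u h
    rw [List.map_cons, (Step.sParams ..).term_iff, (Step.pValue ..).term_iff]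
    exact ih (by simpa using h)

theorem term_apply_iff {K us r v} (h : eval (.app v) us = some r) :
    Term (.apply (us.map .val) :: K) (.exp (.val v)) ↔ Term K r := by
  have hne : FrameId.app v ≠ .map := nofun
  rw [(Step.pValue ..).term_iff, (Step.sAppParam ..).term_iff]
  cases us with
  | nil => exact (Step.pParams₀ _ _ _ _ hne h).term_iff
  | cons u us =>
    rw [List.map_cons, (Step.sParams₀ _ _ _ _ hne).term_iff, (Step.pValue ..).term_iff]
    exact term_params_iff h

/-- The atom `is_function`. -/
def atIsFunction : Atom := [105, 115, 95, 102, 117, 110, 99, 116, 105, 111, 110]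

/-- Whether a value is a closure with `k` parameters. -/
def Val.hasArity (k : ℕ) : Val → Bool
  | .clos _ xs _ => (xs.length : ℤ) == k
  | _ => false

theorem evalCall_isFunction (v : Val) (k : ℕ) :
    evalCall atErlang atIsFunction [v, .int k] = .one (.ofBool (v.hasArity k)) := by
  have h : evalCall atErlang atIsFunction [v, .int k] =
      (Bif.run .isFunction [v, .int k]).getD
        (.error atBadarg (.tuple (.atom atIsFunction :: [v, .int k]))) := rfl
  have hk : (0 : ℤ) ≤ k := Int.natCast_nonneg k
  rw [h]
  cases v <;> simp [Bif.run, Val.hasArity, hk]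

theorem CIUVal.hasArity {v w : Val} (h : CIUVal v w) {k : ℕ} (hv : v.hasArity k = true) :
    w.hasArity k = true := by
  have key : ∀ u : Val, Term [.params (.call (.atom atErlang) (.atom atIsFunction)) []
      ([.int k].map .val), testFrame (.atom atTrue) .nil] (.exp (.val u)) ↔
        u.hasArity k = true := by
    intro u
    rw [(Step.pValue ..).term_iff,
      term_params_iff (r := .one (.ofBool (u.hasArity k))) (by
        rw [List.nil_append, eval, evalCall_isFunction]), Redex.one, term_testFrame_iff]
    cases u.hasArity k
    · have hne : atTrue ≠ atFalse := by decide
      simp [Val.ofBool, Pat.matchVal, hne]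
    · simp only [Val.ofBool, Pat.matchVal, if_true, iff_true]
      exact ⟨[], rfl, (term_nil_vals _).of_step (.pValue ..)⟩
  rw [← key] at hv ⊢
  refine h.2.2 _ (.cons ?_ (.cons (testFrame_closed trivial) (by simp [FrameStack.Closed]))) hv
  simp [Frame.Closed, FrameId.Closed, Val.Closed, Val.Scoped, Val.ScopedAll, Exp.ScopedAll,
    Exp.Scoped]

theorem CIUVal.clos {ext xs e w} (h : CIUVal (.clos ext xs e) w) (n : ℕ) :
    VRel n (.clos ext xs e) w := by
  have ha := h.hasArity (k := xs.length) (by simp [Val.hasArity])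
  cases w <;> simp only [Val.hasArity, Bool.false_eq_true, beq_iff_eq, Nat.cast_inj] at ha
  case clos ext' ys e' =>
    refine VRel.clos_iff.2 ⟨h.1, h.2.1, ha.symm, fun m hm vs ws hl hv => ?_⟩
    have hr : ERel m (e.subst ((mkClosList ext).union (.ofVars xs vs)))
        (e.subst ((mkClosList ext).union (.ofVars xs ws))) :=
      (VRel.clos_iff.1 (VRel.refl h.1 n)).2.2.2 m hm vs ws hl hv
    have hl₁ : ws.length = xs.length := by rw [← hv.length_eq, hl]
    have hl₂ : ws.length = ys.length := hl₁.trans ha.symm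
    have happ := eval_rel hm (.app (VRel.refl h.2.1 n))
      (List.forall₂_same.2 fun u hu => VRel.refl (Val.scopedAll_iff.1
        (VRel.scopedAll_right hv) u hu) n)
    rw [eval, if_pos hl₂] at happ
    have hc : (e'.subst ((mkClosList ext').union (.ofVars ys ws))).Closed := by
      cases happ with
      | some happ =>
        cases happ with
        | exp happ => exact happ.1
    refine ⟨hr.1, hc, fun k hk K₁ K₂ hK ht => ?_⟩
    have ht' := hr.2.2 k hk K₁ K₂ hK ht
    rw [← term_apply_iff (v := .clos ext xs e) (us := ws) (by rw [eval, if_pos hl₁])] at ht'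
    rw [← term_apply_iff (v := .clos ext' ys e') (us := ws) (by rw [eval, if_pos hl₂])]
    refine h.2.2 _ (.cons ?_ hK.2.1) ht'
    simp only [Frame.Closed, Exp.scopedAll_iff, List.mem_map, forall_exists_index, and_imp,
      forall_apply_eq_imp_iff₂]
    exact Val.scopedAll_iff.1 (VRel.scopedAll_right hv)

mutual

theorem CIUVal.vrel : ∀ {v w : Val}, CIUVal v w → ∀ n, VRel n v w
  | .int i, w, h, n => by
      obtain ⟨_, hl, -⟩ := h.matchVal (p := .int i) (l := []) (by simp [Pat.matchVal])
      cases w <;> simp [Pat.matchVal] at hl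
      exact hl.1 ▸ VRel.int n i
  | .atom a, w, h, n => by
      obtain ⟨_, hl, -⟩ := h.matchVal (p := .atom a) (l := []) (by simp [Pat.matchVal])
      cases w <;> simp [Pat.matchVal] at hl
      exact hl.1 ▸ VRel.atom n a
  | .var _, _, h, _ => h.1.elim
  | .fid _ _, _, h, _ => h.1.elim
  | .clos _ _ _, _, h, n => h.clos n
  | .cons _ _, _, h, n => by
      obtain ⟨u, u', rfl, h₁, h₂⟩ := h.cons
      exact VRel.cons_iff.2 ⟨CIUVal.vrel h₁ n, CIUVal.vrel h₂ n⟩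
  | .nil, w, h, n => by
      obtain ⟨_, hl, -⟩ := h.matchVal (p := .nil) (l := []) (by simp [Pat.matchVal])
      cases w <;> simp [Pat.matchVal] at hl
      exact VRel.nil n
  | .tuple vs, _, h, n => by
      obtain ⟨ws, rfl, h'⟩ := h.tuple
      exact VRel.tuple_iff.2 (CIUVal.vrel_list h' n)
  | .map kvs, _, h, n => by
      obtain ⟨kvs', rfl, h'⟩ := h.map
      exact VRel.map_iff.2 (CIUVal.vrel_pairs h' n)

theorem CIUVal.vrel_list : ∀ {vs ws : List Val}, List.Forall₂ CIUVal vs ws →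
    ∀ n, List.Forall₂ (VRel n) vs ws
  | [], _, h, _ => by cases h; exact .nil
  | _ :: _, _, .cons h h', n => .cons (CIUVal.vrel h n) (CIUVal.vrel_list h' n)

theorem CIUVal.vrel_pairs : ∀ {kvs kvs' : List (Val × Val)},
    List.Forall₂ CIUVal (flatten kvs) (flatten kvs') → ∀ n, List.Forall₂ (PRel n) kvs kvs'
  | [], [], _, _ => .nil
  | (_, _) :: _, (_, _) :: _, .cons h (.cons h' t), n =>
      .cons ⟨CIUVal.vrel h n, CIUVal.vrel h' n⟩ (CIUVal.vrel_pairs t n)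
  | [], (_, _) :: _, h, _ => by cases h
  | (_, _) :: _, [], h, _ => by cases h

end

end CoreErlang

theorem mainTheorem6 (v₁ v₂ : CoreErlang.Val) (h₁ : v₁.Closed) (h₂ : v₂.Closed)
    (h : CoreErlang.CIU (.exp (.val v₁)) (.exp (.val v₂))) :
    ∀ n : ℕ, CoreErlang.VRel n v₁ v₂ :=
  CoreErlang.CIUVal.vrel h
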